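/- An instance of joint pricing and assortment optimization in the Markov choice model consists of a number $n$ of products $N=\{1,\dots,n\}$, a finite ladder $P$ of $r$ nonnegative prices $p_1,\dots,p_r$, a bound $k\in\mathbb{N}$ on the number of offered products (void if $k\ge n$), and a Markov chain on the states $N_P=N\times\{1,\dots,r\}$ (product, price) together with the outside option $0$, given by initial probabilities $\lambda_e\ge 0$ with $\sum_{e}\lambda_e\le 1$ and transition probabilities $\rho_{ef}\ge 0$ with $\sum_f\rho_{ef}\le 1$ for $e\in N_P$; the missing mass is the probability of starting at, respectively moving to, $0$. For $S\subseteq N_P$ and $e\in S$ let $\phi(e,S)$ be the probability that the chain reaches $e$ before any other element of $S\cup\{0\}$. A priced assortment is a set of offered products together with one price from the ladder for each of them, that is, a set $S\subseteq N_P$ that contains at most one pair $(i,j)$ for each product $i$; it is feasible if $|S|\le k$, and its expected revenue is $R(S)=\sum_{(i,j)\in S}p_j\,\phi((i,j),S)$. There is a polynomial-time $0.25$-approximation algorithm for maximizing $R$ over the feasible priced assortments: there are one deterministic program of a random access machine with exact real arithmetic ($+,-,\times,/$ and comparison of reals at unit cost, integer constants only; on natural numbers only addition, truncated subtraction and comparison)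 and one polynomial $q$ such that, on every instance, the program halts after at most $q(n+r)$ elementary operations and outputs a feasible priced assortment $S$ with $$R(S)\ \ge\ \tfrac14\,\max\{R(T) : T\text{ a feasible priced assortment}\}.$$ -/

import Mathlib

/-! ## The Markov choice model -/

/-- Markov choice model on a finite set `E` of products (plus an outside option): the customer
starts at product `i` with probability `init i` and moves from product `i` to product `j` with
probability `trans i j`. The missing mass, `1 - ∑ i, init i` and `1 - ∑ j, trans i j`, is the
probability of starting at, respectively moving to, the outside option. -/
structure MarkovChoiceModel (E : Type) [Fintype E] where
  init : E → ℝ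
  trans : E → E → ℝ
  init_nonneg : ∀ i, 0 ≤ init i
  init_sum_le_one : ∑ i, init i ≤ 1
  trans_nonneg : ∀ i j, 0 ≤ trans i j
  trans_sum_le_one : ∀ i, ∑ j, trans i j ≤ 1

namespace MarkovChoiceModel

variable {E : Type} [Fintype E] [DecidableEq E]

/-- `M.visit S t j` is the probability that the customer, when the assortment `S` is offered, makes
`t` transitions without having terminated before and is then at product `j`: the first `t` products
visited are not in `S`, and the next one is `j`. -/
def visit (M : MarkovChoiceModel E) (S : Finset E) : ℕ → E → ℝ
  | 0, j => M.init j
  | t + 1, j => ∑ i ∈ Sᶜ, M.visit S t i * M.trans i j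

/-- The probability `φ(i, S)` that the customer chooses `i ∈ S` from the assortment `S`, i.e. that
`i` is the first element of `S` (or outside option) that is reached. For `i ∈ S` the events
"the walk terminates at `i` after exactly `t` transitions" are disjoint. -/
noncomputable def choiceProb (M : MarkovChoiceModel E) (i : E) (S : Finset E) : ℝ :=
  ∑' t : ℕ, M.visit S t i

/-- Expected revenue of the assortment `S` when product `i` has price `r i`. -/
noncomputable def revenue (M : MarkovChoiceModel E) (r : E → ℝ) (S : Finset E) : ℝ :=
  ∑ i ∈ S, r i * M.choiceProb i S

theorem visit_nonneg (M : MarkovChoiceModel E) (S : Finset E) (t : ℕ) (j : E) :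
    0 ≤ M.visit S t j := by
  induction t generalizing j with
  | zero => exact M.init_nonneg j
  | succ t ih => exact Finset.sum_nonneg fun i _ => mul_nonneg (ih i) (M.trans_nonneg i j)

theorem sum_visit_le_one (M : MarkovChoiceModel E) (S : Finset E) (T : ℕ) :
    ∑ t ∈ Finset.range T, ∑ i ∈ S, M.visit S t i + ∑ j, M.visit S T j ≤ 1 := by
  induction T with
  | zero => simpa [visit] using M.init_sum_le_one
  | succ T ih =>
    have h1 : ∑ j, M.visit S (T + 1) j ≤ ∑ i ∈ Sᶜ, M.visit S T i := by
      simp only [visit]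
      rw [Finset.sum_comm]
      refine Finset.sum_le_sum fun i _ => ?_
      rw [← Finset.mul_sum]
      exact mul_le_of_le_one_right (M.visit_nonneg S T i) (M.trans_sum_le_one i)
    have h2 := Finset.sum_add_sum_compl S (fun i => M.visit S T i)
    rw [Finset.sum_range_succ]
    linarith

/-- The series that defines `choiceProb i S` converges for every offered product `i`. -/
theorem summable_visit (M : MarkovChoiceModel E) {S : Finset E} {i : E} (hi : i ∈ S) :
    Summable fun t => M.visit S t i := by
  refine summable_of_sum_range_le (c := 1) (fun t => M.visit_nonneg S t i) fun T => ?_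
  have h1 := M.sum_visit_le_one S T
  have h2 : 0 ≤ ∑ j, M.visit S T j := Finset.sum_nonneg fun j _ => M.visit_nonneg S T j
  have h3 : ∑ t ∈ Finset.range T, M.visit S t i ≤
      ∑ t ∈ Finset.range T, ∑ i ∈ S, M.visit S t i :=
    Finset.sum_le_sum fun t _ =>
      Finset.single_le_sum (f := fun i => M.visit S t i) (fun j _ => M.visit_nonneg S t j) hi
  linarith

end MarkovChoiceModel

/-! ## Joint pricing and assortment optimization -/

/-- An instance with `n` products and a ladder of `r` possible prices. The choice model is a Markov
choice model on the pairs (product, price); at most `k` products may be offered (there is no such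
restriction if `n ≤ k`). -/
structure PricingInstance (n r : ℕ) where
  k : ℕ
  price : Fin r → ℝ
  price_nonneg : ∀ p, 0 ≤ price p
  model : MarkovChoiceModel (Fin n × Fin r)

/-- A decision: `σ i = none` if product `i` is not offered, `σ i = some p` if it is offered at the
`p`-th price of the ladder. -/
abbrev PricedAssortment (n r : ℕ) : Type := Fin n → Option (Fin r)

/-- The pairs (product, price) that are offered. -/
def PricedAssortment.offered {n r : ℕ} (σ : PricedAssortment n r) : Finset (Fin n × Fin r) :=
  Finset.univ.filter fun e => σ e.1 = some e.2

namespace PricingInstance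

variable {n r : ℕ}

/-- At most `k` products are offered. -/
def Feasible (I : PricingInstance n r) (σ : PricedAssortment n r) : Prop :=
  (Finset.univ.filter fun i => σ i ≠ none).card ≤ I.k

/-- The expected revenue of a priced assortment. -/
noncomputable def revenue (I : PricingInstance n r) (σ : PricedAssortment n r) : ℝ :=
  I.model.revenue (fun e => I.price e.2) (PricedAssortment.offered σ)

end PricingInstance

/-! ## Real random access machine

A small imperative language with arrays of natural numbers and arrays of real numbers. Arithmetic
operations and comparisons of real numbers are exact and have unit cost. On natural numbers there is
only addition, truncated subtraction and comparison. The only constants are natural numbers. -/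

namespace RealRAM

/-- Memory: arrays with names in `ℕ`, whose cells are addressed by finite lists of natural numbers.
A scalar variable `x` is the cell with the empty address of array `x`. -/
structure Store where
  nat : ℕ → List ℕ → ℕ
  real : ℕ → List ℕ → ℝ

namespace Store

/-- The address given by the contents of the scalar variables listed in `ix`. -/
def addr (s : Store) (ix : List ℕ) : List ℕ := ix.map fun x => s.nat x []

def setNat (s : Store) (a : ℕ) (l : List ℕ) (v : ℕ) : Store :=
  { s with nat := Function.update s.nat a (Function.update (s.nat a) l v) }

noncomputable def setReal (s : Store) (a : ℕ) (l : List ℕ) (v : ℝ) : Store :=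
  { s with real := Function.update s.real a (Function.update (s.real a) l v) }

end Store

/-- Expressions for natural numbers; `read a [x₁, …, x_d]` is the cell `a[x₁, …, x_d]`, whose indices
are the contents of the scalar variables `x₁, …, x_d`. -/
inductive NatExpr where
  | lit (c : ℕ)
  | read (a : ℕ) (ix : List ℕ)
  | add (e f : NatExpr)
  | sub (e f : NatExpr)

namespace NatExpr

def eval (s : Store) : NatExpr → ℕ
  | lit c => c
  | read a ix => s.nat a (s.addr ix)
  | add e f => e.eval s + f.eval s
  | sub e f => e.eval s - f.eval s

def cost : NatExpr → ℕ
  | lit _ => 1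
  | read _ ix => 1 + ix.length
  | add e f => e.cost + f.cost + 1
  | sub e f => e.cost + f.cost + 1

end NatExpr

/-- Expressions for real numbers; indices as in `NatExpr`. Division by zero yields zero. -/
inductive RealExpr where
  | lit (c : ℕ)
  | read (a : ℕ) (ix : List ℕ)
  | add (e f : RealExpr)
  | sub (e f : RealExpr)
  | mul (e f : RealExpr)
  | div (e f : RealExpr)

namespace RealExpr

noncomputable def eval (s : Store) : RealExpr → ℝ
  | lit c => (c : ℝ)
  | read a ix => s.real a (s.addr ix)
  | add e f => e.eval s + f.eval s
  | sub e f => e.eval s - f.eval s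
  | mul e f => e.eval s * f.eval s
  | div e f => e.eval s / f.eval s

def cost : RealExpr → ℕ
  | lit _ => 1
  | read _ ix => 1 + ix.length
  | add e f => e.cost + f.cost + 1
  | sub e f => e.cost + f.cost + 1
  | mul e f => e.cost + f.cost + 1
  | div e f => e.cost + f.cost + 1

end RealExpr

/-- Tests for branching. -/
inductive Test where
  | natLe (e f : NatExpr)
  | realLe (e f : RealExpr)
  | not (b : Test)
  | and (b c : Test)

namespace Test

def Holds (s : Store) : Test → Prop
  | natLe e f => e.eval s ≤ f.eval s
  | realLe e f => e.eval s ≤ f.eval s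
  | not b => ¬ b.Holds s
  | and b c => b.Holds s ∧ c.Holds s

def cost : Test → ℕ
  | natLe e f => e.cost + f.cost + 1
  | realLe e f => e.cost + f.cost + 1
  | not b => b.cost + 1
  | and b c => b.cost + c.cost + 1

end Test

/-- Programs. `setNat a ix e` is the assignment `a[ix] := e`, and likewise `setReal`. -/
inductive Prog where
  | skip
  | setNat (a : ℕ) (ix : List ℕ) (e : NatExpr)
  | setReal (a : ℕ) (ix : List ℕ) (e : RealExpr)
  | seq (P Q : Prog)
  | ite (b : Test) (P Q : Prog)
  | while (b : Test) (P : Prog)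

/-- `Exec P s t s'`: the program `P`, started in the store `s`, halts after exactly `t` elementary
operations in the store `s'`. The rules are deterministic. -/
inductive Exec : Prog → Store → ℕ → Store → Prop where
  | skip (s : Store) : Exec Prog.skip s 1 s
  | setNat (a : ℕ) (ix : List ℕ) (e : NatExpr) (s : Store) :
      Exec (Prog.setNat a ix e) s (1 + ix.length + e.cost) (s.setNat a (s.addr ix) (e.eval s))
  | setReal (a : ℕ) (ix : List ℕ) (e : RealExpr) (s : Store) :
      Exec (Prog.setReal a ix e) s (1 + ix.length + e.cost) (s.setReal a (s.addr ix) (e.eval s))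
  | seq {P Q : Prog} {s s₁ s₂ : Store} {t u : ℕ} (hP : Exec P s t s₁) (hQ : Exec Q s₁ u s₂) :
      Exec (Prog.seq P Q) s (t + u) s₂
  | ite_true {b : Test} {P Q : Prog} {s s₁ : Store} {t : ℕ} (hb : b.Holds s) (hP : Exec P s t s₁) :
      Exec (Prog.ite b P Q) s (b.cost + t) s₁
  | ite_false {b : Test} {P Q : Prog} {s s₁ : Store} {t : ℕ} (hb : ¬ b.Holds s)
      (hQ : Exec Q s t s₁) : Exec (Prog.ite b P Q) s (b.cost + t) s₁
  | while_false {b : Test} {P : Prog} {s : Store} (hb : ¬ b.Holds s) :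
      Exec (Prog.while b P) s b.cost s
  | while_true {b : Test} {P : Prog} {s s₁ s₂ : Store} {t u : ℕ} (hb : b.Holds s)
      (hP : Exec P s t s₁) (hW : Exec (Prog.while b P) s₁ u s₂) :
      Exec (Prog.while b P) s (b.cost + t + u) s₂

end RealRAM

namespace PricingInstance

variable {n r : ℕ}

/-- The natural number part of the input: the scalars `0, 1, 2` hold `n`, `r`, `k`. -/
def inputNat (I : PricingInstance n r) : ℕ → List ℕ → ℕ
  | 0, [] => n
  | 1, [] => r
  | 2, [] => I.k
  | _, _ => 0

/-- The real part of the input: array `0` holds the prices, array `1` the initial probabilities,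
array `2` the transition probabilities, with indices counted from `0`. -/
noncomputable def inputReal (I : PricingInstance n r) : ℕ → List ℕ → ℝ
  | 0, [p] => if h : p < r then I.price ⟨p, h⟩ else 0
  | 1, [i, p] => if h : i < n ∧ p < r then I.model.init (⟨i, h.1⟩, ⟨p, h.2⟩) else 0
  | 2, [i, p, j, q] =>
      if h : (i < n ∧ p < r) ∧ (j < n ∧ q < r) then
        I.model.trans (⟨i, h.1.1⟩, ⟨p, h.1.2⟩) (⟨j, h.2.1⟩, ⟨q, h.2.2⟩)
      else 0
  | _, _ => 0

/-- The store in which the program is started. -/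
noncomputable def input (I : PricingInstance n r) : RealRAM.Store where
  nat := I.inputNat
  real := I.inputReal

end PricingInstance

/-- The natural number array `3` of the store holds the priced assortment `σ`: cell `i` is `0` if
product `i` is not offered, and `p + 1` if it is offered at the `p`-th price. -/
def RealRAM.Store.Outputs {n r : ℕ} (s : RealRAM.Store) (σ : PricedAssortment n r) : Prop :=
  ∀ i : Fin n, s.nat 3 [(i : ℕ)] = (σ i).elim 0 fun p => (p : ℕ) + 1

/-! Revenue in a Markov choice model is in general neither monotone nor submodular, but a suitable
order of the pairs makes it behave well enough. A customer who stops at `c ∈ C` when `A ∪ C` is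
offered would, were `C` withdrawn, walk on from `c` and earn `R_c(A)`, the revenue of the chain
started at `c`. Hence `R(A ∪ C) = R(A) + ∑ φ(c, A ∪ C) (p_c - R_c(A))` (`revenue_union`). The
bracket, the adjusted price, depends on `A` only, and `φ` decreases in the assortment
(`choiceProb_anti`).

A local search examines every pair once, always an unexamined pair `e` of largest adjusted price
with respect to the set `A` of all pairs accepted so far, including those dropped again. By this
choice `p_e ≥ R_e(S)` for every `S` between `A` and `A` plus the unexamined pairs, so adding `e` to
such an `S` never loses revenue, wherever the customer starts. The weight of `e` is its marginal
revenue `w`; it is accepted if `w` exceeds twice the weight of what must leave: the same product at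
an old price, nothing if there is room, otherwise a lightest offered product.

With `W` the total weight of the current assortment `σ`, `Invariant` yields three facts. Weights are
marginals against larger sets than needed, so `W ≤ R(σ)`. Every newcomer weighs more than twice what
it displaces, so `R(A) ≤ 2W`. A competitor `τ` loses at most `2 max(α, wt i)` per rejected pair,
where `α` bounds the offered weights from below; by the duality in `sum_max_le_sum` these losses
total at most `2W`. Thus `R(τ) ≤ 4W ≤ 4R(σ)` (`Invariant.quarter_le`). A threshold `c` instead of
`2` would give `c + c/(c-1)`, which is least at `c = 2`.

Choice probabilities are computed by Gaussian elimination of the states outside the assortment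
(`choiceProb_eliminate`, `run_evaluate`). The program is written in a language whose loops are
bounded by `n` or `r`, so that polynomial time follows from its syntax (`exec_run`), and correctness
is proved for the denotation `Cmd.run`. -/

namespace MarkovChoiceModel

open Finset

variable {E : Type} [Fintype E] [DecidableEq E]

/-! ### First passage probabilities -/

/-- The same chain, started at `e`. -/
def startAt (M : MarkovChoiceModel E) (e : E) : MarkovChoiceModel E where
  init := Pi.single e 1
  trans := M.trans
  init_nonneg i := by by_cases h : i = e <;> simp [h]
  init_sum_le_one := by simp
  trans_nonneg := M.trans_nonneg
  trans_sum_le_one := M.trans_sum_le_one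

/-- The same chain, started with a transition from `e`. -/
def startAfter (M : MarkovChoiceModel E) (e : E) : MarkovChoiceModel E where
  init := M.trans e
  trans := M.trans
  init_nonneg := M.trans_nonneg e
  init_sum_le_one := M.trans_sum_le_one e
  trans_nonneg := M.trans_nonneg
  trans_sum_le_one := M.trans_sum_le_one

theorem visit_startAt_succ (M : MarkovChoiceModel E) {S : Finset E} {e : E} (he : e ∉ S)
    (t : ℕ) (j : E) : (M.startAt e).visit S (t + 1) j = (M.startAfter e).visit S t j := by
  induction t generalizing j with
  | zero =>
    simp only [visit, startAt, startAfter, Pi.single_apply, ite_mul, one_mul, zero_mul]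
    rw [Finset.sum_ite_eq']
    simp [he]
  | succ t ih =>
    rw [visit, visit]
    exact Finset.sum_congr rfl fun i _ => by rw [ih]; rfl

theorem visit_startAt_zero (M : MarkovChoiceModel E) {S : Finset E} {e j : E} (h : j ≠ e) :
    (M.startAt e).visit S 0 j = 0 := by
  simp [visit, startAt, h]

theorem choiceProb_nonneg (M : MarkovChoiceModel E) (i : E) (S : Finset E) :
    0 ≤ M.choiceProb i S :=
  tsum_nonneg fun t => M.visit_nonneg S t i

/-- From a state outside `S` the first transition is forced. This links the first passage
decomposition, which restarts at a state, with the rows of the matrix that elimination produces. -/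
theorem choiceProb_startAt (M : MarkovChoiceModel E) {S : Finset E} {e i : E} (he : e ∉ S)
    (hi : i ∈ S) : (M.startAt e).choiceProb i S = (M.startAfter e).choiceProb i S := by
  have hne : i ≠ e := fun h => he (h ▸ hi)
  unfold choiceProb
  rw [((M.startAt e).summable_visit hi).tsum_eq_zero_add, visit_startAt_zero M hne, zero_add]
  exact tsum_congr fun t => visit_startAt_succ M he t i

theorem sum_choiceProb_le_one (M : MarkovChoiceModel E) (S : Finset E) :
    ∑ i ∈ S, M.choiceProb i S ≤ 1 := by
  unfold choiceProb
  rw [← Summable.tsum_finsetSum fun i hi => M.summable_visit hi]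
  refine Summable.tsum_le_of_sum_range_le (summable_sum fun i hi => M.summable_visit hi)
    fun T => ?_
  have h1 := M.sum_visit_le_one S T
  have h2 : 0 ≤ ∑ j, M.visit S T j := Finset.sum_nonneg fun j _ => M.visit_nonneg S T j
  linarith

/-- First passage decomposition: a walk that has not met `A` may have met `C` before. -/
theorem visit_eq_add_sum (M : MarkovChoiceModel E) {A C : Finset E} (hAC : Disjoint A C)
    (T : ℕ) (j : E) :
    M.visit A T j = M.visit (A ∪ C) T j +
      ∑ c ∈ C, ∑ t ∈ range T, M.visit (A ∪ C) t c * (M.startAt c).visit A (T - t) j := by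
  induction T generalizing j with
  | zero => simp [visit]
  | succ T ih =>
    have hcompl : Aᶜ = (A ∪ C)ᶜ ∪ C := by
      ext x
      have := fun h : x ∈ A => Finset.disjoint_left.1 hAC h
      simp only [mem_compl, mem_union]
      tauto
    have hdisj : Disjoint (A ∪ C)ᶜ C := by
      rw [Finset.disjoint_left]
      intro x hx
      simp only [mem_compl, mem_union] at hx
      tauto
    have hstep : ∀ c ∈ C, ∀ t ∈ range T,
        ∑ i ∈ Aᶜ, (M.visit (A ∪ C) t c * (M.startAt c).visit A (T - t) i) * M.trans i j =
          M.visit (A ∪ C) t c * (M.startAt c).visit A (T + 1 - t) j := by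
      intro c _ t ht
      rw [Nat.succ_sub (Finset.mem_range.1 ht).le, visit, Finset.mul_sum]
      exact Finset.sum_congr rfl fun i _ => by rw [mul_assoc]; rfl
    -- Walks that first meet `C` at time `T` itself supply the new summand `t = T`.
    have hlast : ∀ c ∈ C, (M.startAt c).visit A 1 j = M.trans c j := by
      intro c hc
      rw [visit_startAt_succ M (Finset.disjoint_right.1 hAC hc)]
      rfl
    have hmain : M.visit A (T + 1) j =
        ∑ i ∈ Aᶜ, M.visit (A ∪ C) T i * M.trans i j +
          ∑ c ∈ C, ∑ t ∈ range T,
            M.visit (A ∪ C) t c * (M.startAt c).visit A (T + 1 - t) j := by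
      rw [visit, Finset.sum_congr rfl fun i _ => by rw [ih i, add_mul],
        Finset.sum_add_distrib]
      congr 1
      rw [Finset.sum_congr rfl fun i _ => by
        rw [Finset.sum_mul, Finset.sum_congr rfl fun c _ => Finset.sum_mul _ _ _],
        Finset.sum_comm]
      refine Finset.sum_congr rfl fun c hc => ?_
      rw [Finset.sum_comm]
      exact Finset.sum_congr rfl fun t ht => hstep c hc t ht
    have hsplit : ∀ c ∈ C, ∑ t ∈ range (T + 1),
        M.visit (A ∪ C) t c * (M.startAt c).visit A (T + 1 - t) j =
        ∑ t ∈ range T, M.visit (A ∪ C) t c * (M.startAt c).visit A (T + 1 - t) j +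
          M.visit (A ∪ C) T c * M.trans c j := by
      intro c hc
      rw [Finset.sum_range_succ, Nat.add_sub_cancel_left, hlast c hc]
    rw [hmain, hcompl, Finset.sum_union hdisj, Finset.sum_congr rfl hsplit,
      Finset.sum_add_distrib, visit]
    ring

/-- Summing the first passage decomposition over all times turns the convolution into a product of
two series (Cauchy product). -/
theorem choiceProb_eq_add_sum (M : MarkovChoiceModel E) {A C : Finset E} (hAC : Disjoint A C)
    {a : E} (ha : a ∈ A) :
    M.choiceProb a A = M.choiceProb a (A ∪ C) +
      ∑ c ∈ C, M.choiceProb c (A ∪ C) * (M.startAt c).choiceProb a A := by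
  have hS : ∀ c ∈ C, c ∈ A ∪ C := fun c hc => Finset.mem_union_right _ hc
  have hconv : ∀ c ∈ C, ∀ T, ∑ t ∈ range T,
      M.visit (A ∪ C) t c * (M.startAt c).visit A (T - t) a =
      ∑ t ∈ range (T + 1), M.visit (A ∪ C) t c * (M.startAt c).visit A (T - t) a := by
    -- The Cauchy product also has the term `t = T`; it vanishes because a walk started at `c` is
    -- not at `a ≠ c` at time 0.
    intro c hc T
    rw [Finset.sum_range_succ, Nat.sub_self, visit_startAt_zero M
      (fun h => Finset.disjoint_left.1 hAC ha (by rwa [h])), mul_zero, add_zero]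
  have hnorm : ∀ (N : MarkovChoiceModel E) (S : Finset E) (i : E), i ∈ S →
      Summable fun t => ‖N.visit S t i‖ := fun N S i hi => (N.summable_visit hi).norm
  have hsum : ∀ c ∈ C, Summable fun T => ∑ t ∈ range (T + 1),
      M.visit (A ∪ C) t c * (M.startAt c).visit A (T - t) a := fun c hc =>
    (summable_norm_sum_mul_range_of_summable_norm (hnorm M _ c (hS c hc))
      (hnorm (M.startAt c) _ a ha)).of_norm
  have hprod : ∀ c ∈ C, M.choiceProb c (A ∪ C) * (M.startAt c).choiceProb a A =
      ∑' T, ∑ t ∈ range (T + 1), M.visit (A ∪ C) t c * (M.startAt c).visit A (T - t) a :=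
    fun c hc => tsum_mul_tsum_eq_tsum_sum_range_of_summable_norm (hnorm M _ c (hS c hc))
      (hnorm (M.startAt c) _ a ha)
  rw [Finset.sum_congr rfl hprod, ← Summable.tsum_finsetSum hsum]
  unfold choiceProb
  rw [← Summable.tsum_add (M.summable_visit (Finset.mem_union_left _ ha)) (summable_sum hsum)]
  refine tsum_congr fun T => ?_
  rw [visit_eq_add_sum M hAC]
  congr 1
  exact Finset.sum_congr rfl fun c hc => hconv c hc T

theorem choiceProb_anti (M : MarkovChoiceModel E) {A B : Finset E} (hAB : A ⊆ B) {a : E}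
    (ha : a ∈ A) : M.choiceProb a B ≤ M.choiceProb a A := by
  have h := M.choiceProb_eq_add_sum (A := A) (C := B \ A) Finset.disjoint_sdiff ha
  rw [Finset.union_sdiff_of_subset hAB] at h
  rw [h]
  exact le_add_of_nonneg_right (Finset.sum_nonneg fun c _ =>
    mul_nonneg (M.choiceProb_nonneg _ _) ((M.startAt c).choiceProb_nonneg _ _))

/-! ### Marginal revenues -/

/-- Stopping at `c` earns `r c` but forgoes what the same customer would have spent in `A` later on.
All estimates of the local search derive from this identity. -/
theorem revenue_union (M : MarkovChoiceModel E) (r : E → ℝ) {A C : Finset E}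
    (hAC : Disjoint A C) :
    M.revenue r (A ∪ C) = M.revenue r A +
      ∑ c ∈ C, M.choiceProb c (A ∪ C) * (r c - (M.startAt c).revenue r A) := by
  unfold revenue
  rw [Finset.sum_union hAC, Finset.sum_congr rfl fun a ha => by
    rw [← sub_eq_iff_eq_add.2 (M.choiceProb_eq_add_sum hAC ha)]]
  simp only [mul_sub, Finset.mul_sum, Finset.sum_sub_distrib]
  rw [Finset.sum_comm]
  have : ∀ c a, M.choiceProb c (A ∪ C) * (r a * (M.startAt c).choiceProb a A) =
    r a * (M.choiceProb c (A ∪ C) * (M.startAt c).choiceProb a A) := fun c a => by ring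
  simp only [this, mul_comm (M.choiceProb _ (A ∪ C)) (r _)]
  ring

theorem revenue_insert (M : MarkovChoiceModel E) (r : E → ℝ) {A : Finset E} {c : E}
    (hc : c ∉ A) :
    M.revenue r (insert c A) = M.revenue r A +
      M.choiceProb c (insert c A) * (r c - (M.startAt c).revenue r A) := by
  have h := M.revenue_union r (A := A) (C := {c}) (by simpa using hc)
  rwa [Finset.union_comm, ← Finset.insert_eq, Finset.sum_singleton] at h

theorem revenue_le_insert (M : MarkovChoiceModel E) (r : E → ℝ) {A : Finset E} {c : E}
    (h : (M.startAt c).revenue r A ≤ r c) : M.revenue r A ≤ M.revenue r (insert c A) := by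
  by_cases hc : c ∈ A
  · rw [Finset.insert_eq_of_mem hc]
  · rw [M.revenue_insert r hc]
    exact le_add_of_nonneg_right (mul_nonneg (M.choiceProb_nonneg _ _) (sub_nonneg.2 h))

/-- Adding `C` to `A` earns at most the largest adjusted price. -/
theorem revenue_union_le (M : MarkovChoiceModel E) (r : E → ℝ) {A C : Finset E}
    (hAC : Disjoint A C) {b : ℝ} (hb : 0 ≤ b)
    (h : ∀ c ∈ C, r c - (M.startAt c).revenue r A ≤ b) :
    M.revenue r (A ∪ C) ≤ M.revenue r A + b := by
  rw [M.revenue_union r hAC]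
  gcongr
  calc ∑ c ∈ C, M.choiceProb c (A ∪ C) * (r c - (M.startAt c).revenue r A)
      ≤ ∑ c ∈ C, M.choiceProb c (A ∪ C) * b :=
        Finset.sum_le_sum fun c hc => mul_le_mul_of_nonneg_left (h c hc) (M.choiceProb_nonneg _ _)
    _ ≤ ∑ c ∈ A ∪ C, M.choiceProb c (A ∪ C) * b :=
        Finset.sum_le_sum_of_subset_of_nonneg Finset.subset_union_right
          fun c _ _ => mul_nonneg (M.choiceProb_nonneg _ _) hb
    _ = (∑ c ∈ A ∪ C, M.choiceProb c (A ∪ C)) * b := (Finset.sum_mul _ _ _).symm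
    _ ≤ b := mul_le_of_le_one_left hb (M.sum_choiceProb_le_one _)

/-- Giving up one product of `C`, and those with negative adjusted price, costs at most the
marginal revenue of that product. -/
theorem exists_revenue_union_le_erase (M : MarkovChoiceModel E) (r : E → ℝ) {A C : Finset E}
    (hAC : Disjoint A C) {e : E} (he : e ∉ A) :
    ∃ D ⊆ C.erase e, M.revenue r (A ∪ C) ≤ M.revenue r (A ∪ D) +
      max 0 (M.choiceProb e (insert e A) * (r e - (M.startAt e).revenue r A)) := by
  set ρ : E → ℝ := fun c => r c - (M.startAt c).revenue r A with hρ
  refine ⟨(C.erase e).filter fun c => 0 < ρ c, Finset.filter_subset _ _, ?_⟩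
  set D := (C.erase e).filter fun c => 0 < ρ c with hD
  have hDC : D ⊆ C := (Finset.filter_subset _ _).trans (Finset.erase_subset _ _)
  rw [M.revenue_union r hAC, M.revenue_union r (Finset.disjoint_of_subset_right hDC hAC), add_assoc]
  gcongr
  -- Shrinking `C` to `D` raises the choice probabilities of the remaining pairs, whose adjusted
  -- prices are positive; only the term of `e` has to be paid for.
  have hterm : ∀ c ∈ C, M.choiceProb c (A ∪ C) * ρ c ≤
      (if c ∈ D then M.choiceProb c (A ∪ D) * ρ c else 0) +
        if c = e then max 0 (M.choiceProb e (insert e A) * ρ e) else 0 := by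
    intro c hc
    by_cases hce : c = e
    · subst hce
      have hcD : c ∉ D := by simp [hD]
      rw [if_neg hcD, if_pos rfl, zero_add]
      rcases le_total (ρ c) 0 with h0 | h0
      · exact (mul_nonpos_of_nonneg_of_nonpos (M.choiceProb_nonneg _ _) h0).trans
          (le_max_left _ _)
      · refine le_trans (mul_le_mul_of_nonneg_right (M.choiceProb_anti ?_ ?_) h0) (le_max_right _ _)
        · exact Finset.insert_subset (Finset.mem_union_right _ hc) Finset.subset_union_left
        · simp
    · rw [if_neg hce, add_zero]
      by_cases h0 : 0 < ρ c
      · have hcD : c ∈ D := by simp [hD, hce, hc, h0]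
        rw [if_pos hcD]
        exact mul_le_mul_of_nonneg_right (M.choiceProb_anti
          (Finset.union_subset_union_right hDC) (Finset.mem_union_right _ hcD)) h0.le
      · rw [if_neg (by simp [hD, h0])]
        exact mul_nonpos_of_nonneg_of_nonpos (M.choiceProb_nonneg _ _) (not_lt.1 h0)
  refine (Finset.sum_le_sum hterm).trans ?_
  rw [Finset.sum_add_distrib, ← Finset.sum_filter, Finset.filter_mem_eq_inter,
    Finset.inter_eq_right.2 hDC, Finset.sum_ite_eq']
  gcongr
  split_ifs
  · exact le_rfl
  · exact le_max_left _ _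

/-! ### State elimination -/

theorem choiceProb_univ (M : MarkovChoiceModel E) (f : E) : M.choiceProb f univ = M.init f := by
  unfold choiceProb
  rw [tsum_eq_single 0]
  · rfl
  · rintro (_ | t) ht
    · exact absurd rfl ht
    · simp [visit]

/-- The number of returns to `x` before `A` is geometric. The convention `a / 0 = 0` is the right
one: if the return to `x` is certain, `A` is never reached. -/
theorem choiceProb_startAfter_eq_div (M : MarkovChoiceModel E) {A : Finset E} {x f : E}
    (hx : x ∉ A) (hf : f ∈ A) :
    (M.startAfter x).choiceProb f A = (M.startAfter x).choiceProb f (insert x A) /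
      (1 - (M.startAfter x).choiceProb x (insert x A)) := by
  set N := M.startAfter x with hN
  have hd : Disjoint A {x} := by simpa using hx
  have hU : A ∪ {x} = insert x A := by rw [Finset.union_comm, ← Finset.insert_eq]
  have key := N.choiceProb_eq_add_sum hd hf
  rw [hU, Finset.sum_singleton, N.choiceProb_startAt hx hf] at key
  change _ = _ + _ * N.choiceProb f A at key
  by_cases h1 : 1 - N.choiceProb x (insert x A) = 0
  · rw [h1, div_zero]
    have hsum := N.sum_choiceProb_le_one (insert x A)
    rw [Finset.sum_insert hx] at hsum
    have hle : N.choiceProb f (insert x A) ≤ ∑ i ∈ A, N.choiceProb i (insert x A) :=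
      Finset.single_le_sum (f := fun i => N.choiceProb i (insert x A))
        (fun i _ => N.choiceProb_nonneg _ _) hf
    have hzero : N.choiceProb f (insert x A) = 0 :=
      le_antisymm (by linarith) (N.choiceProb_nonneg _ _)
    have hv : ∀ t, N.visit (insert x A) t f = 0 := fun t =>
      le_antisymm (hzero ▸ (N.summable_visit (Finset.mem_insert_of_mem hf)).le_tsum t
        fun s _ => N.visit_nonneg _ s f) (N.visit_nonneg _ t f)
    -- Division of the first passage identity is impossible here. Instead, a walk to `f` must first
    -- return to `x`, and from there it is a shorter walk of the same chain.
    have hvA : ∀ T, N.visit A T f = 0 := by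
      intro T
      induction T using Nat.strong_induction_on with
      | _ T ih =>
        rw [N.visit_eq_add_sum hd, hU, hv, Finset.sum_singleton, zero_add]
        refine Finset.sum_eq_zero fun t ht => ?_
        obtain ⟨m, hm⟩ : ∃ m, T - t = m + 1 :=
          ⟨T - t - 1, by have := Finset.mem_range.1 ht; omega⟩
        rw [hm, N.visit_startAt_succ hx]
        change _ * N.visit A m f = 0
        rw [ih m (by omega), mul_zero]
    unfold choiceProb
    simp [hvA]
  · rw [eq_div_iff h1]
    linarith

/-- Elimination of the state `x`. -/
theorem choiceProb_eliminate (M : MarkovChoiceModel E) {A : Finset E} {x f : E}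
    (hx : x ∉ A) (hf : f ∈ A) :
    M.choiceProb f A = M.choiceProb f (insert x A) + M.choiceProb x (insert x A) *
      ((M.startAfter x).choiceProb f (insert x A) /
        (1 - (M.startAfter x).choiceProb x (insert x A))) := by
  have hd : Disjoint A {x} := by simpa using hx
  have key := M.choiceProb_eq_add_sum hd hf
  rwa [Finset.union_comm, ← Finset.insert_eq, Finset.sum_singleton, M.choiceProb_startAt hx hf,
    M.choiceProb_startAfter_eq_div hx hf] at key

end MarkovChoiceModel

/-! ### The local search and its approximation guarantee -/

namespace PricingInstance

open Finset

variable {n r : ℕ}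

/-- The products that are offered. -/
def support (σ : PricedAssortment n r) : Finset (Fin n) :=
  Finset.univ.filter fun i => σ i ≠ none

theorem mem_support {σ : PricedAssortment n r} {i : Fin n} : i ∈ support σ ↔ σ i ≠ none := by
  simp [support]

theorem mem_offered {σ : PricedAssortment n r} {e : Fin n × Fin r} :
    e ∈ PricedAssortment.offered σ ↔ σ e.1 = some e.2 := by
  simp [PricedAssortment.offered]

/-- The expected revenue of an arbitrary set of pairs. -/
noncomputable def setRevenue (I : PricingInstance n r) (S : Finset (Fin n × Fin r)) : ℝ :=
  I.model.revenue (fun e => I.price e.2) S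

/-- The expected revenue of a customer who is at the pair `e`. -/
noncomputable def revenueAt (I : PricingInstance n r) (S : Finset (Fin n × Fin r))
    (e : Fin n × Fin r) : ℝ :=
  (I.model.startAt e).revenue (fun e => I.price e.2) S

/-- The gain from stopping a customer at `e` instead of letting her go on to `A`. -/
noncomputable def adjustedPrice (I : PricingInstance n r) (A : Finset (Fin n × Fin r))
    (e : Fin n × Fin r) : ℝ :=
  I.price e.2 - I.revenueAt A e

/-- The marginal revenue of `e` with respect to `A`, if `e ∉ A`. -/
noncomputable def marginal (I : PricingInstance n r) (A : Finset (Fin n × Fin r))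
    (e : Fin n × Fin r) : ℝ :=
  I.model.choiceProb e (insert e A) * I.adjustedPrice A e

/-- The local search keeps a feasible `σ` with weights `wt` of the offered products, the set `A` of
all pairs that have ever been offered and the set `U` of the pairs still to be examined. -/
structure Invariant (I : PricingInstance n r) (σ : PricedAssortment n r) (wt : Fin n → ℝ)
    (A U : Finset (Fin n × Fin r)) : Prop where
  offered_subset : PricedAssortment.offered σ ⊆ A
  disjoint : Disjoint A U
  feasible : (support σ).card ≤ I.k
  wt_nonneg : ∀ i, 0 ≤ wt i
  wt_none : ∀ i, σ i = none → wt i = 0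
  -- The substitute for monotonicity: from any starting state, offering all of `A` in addition does
  -- no harm.
  revenueAt_mono : ∀ S ⊆ A ∪ U, ∀ e, I.revenueAt S e ≤ I.revenueAt (S ∪ A) e
  weights : ∃ ω : Fin n × Fin r → ℝ, (∀ S ⊆ A, ∑ e ∈ S, ω e ≤ I.setRevenue S) ∧
    ∀ i p, σ i = some p → wt i = ω (i, p)
  accepted : I.setRevenue A ≤ 2 * ∑ i, wt i
  -- `α` is the dual price of the cardinality bound, hence zero unless the bound is tight. `D` is
  -- what is left of `τ` among the unexamined pairs; the sum pays for the rejected ones.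
  bound : ∃ α : ℝ, 0 ≤ α ∧ (∀ i, σ i ≠ none → α ≤ wt i) ∧ (α = 0 ∨ I.k ≤ (support σ).card) ∧
    ∀ τ : PricedAssortment n r, I.Feasible τ → ∃ D ⊆ PricedAssortment.offered τ ∩ U,
      I.setRevenue (PricedAssortment.offered τ) ≤ I.setRevenue (A ∪ D) +
        ∑ e ∈ PricedAssortment.offered τ \ (A ∪ U), 2 * max α (wt e.1)

/-- The product `v` makes room for the product `i`; `v = i` if no other product has to leave. -/
def IsVictim (I : PricingInstance n r) (σ : PricedAssortment n r) (wt : Fin n → ℝ)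
    (i v : Fin n) : Prop :=
  (v = i ∧ (σ i ≠ none ∨ (support σ).card < I.k)) ∨
    (σ i = none ∧ I.k ≤ (support σ).card ∧
      (1 ≤ I.k → σ v ≠ none ∧ ∀ j, σ j ≠ none → wt v ≤ wt j))

theorem invariant_initial (I : PricingInstance n r) :
    I.Invariant (fun _ => none) (fun _ => 0) ∅ univ where
  offered_subset := by
    intro e he
    simp [mem_offered] at he
  disjoint := Finset.disjoint_empty_left _
  feasible := by simp [support]
  wt_nonneg _ := le_rfl
  wt_none _ _ := rfl
  revenueAt_mono S _ e := by simp
  weights := ⟨0, by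
    intro S hS
    rw [Finset.subset_empty.1 hS]
    simp [setRevenue, MarkovChoiceModel.revenue], by simp⟩
  accepted := by simp [setRevenue, MarkovChoiceModel.revenue]
  bound := ⟨0, le_rfl, by simp, Or.inl rfl, fun τ _ =>
    ⟨PricedAssortment.offered τ, by simp, by simp⟩⟩

/-- Rejecting a pair of small marginal revenue. -/
theorem Invariant.reject {I : PricingInstance n r} {σ : PricedAssortment n r} {wt : Fin n → ℝ}
    {A U : Finset (Fin n × Fin r)} (h : I.Invariant σ wt A U) {e : Fin n × Fin r} (he : e ∈ U)
    {v : Fin n} (hv : I.IsVictim σ wt e.1 v) (hw : 1 ≤ I.k → I.marginal A e ≤ 2 * wt v) :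
    I.Invariant σ wt A (U.erase e) where
  offered_subset := h.offered_subset
  disjoint := Finset.disjoint_of_subset_right (Finset.erase_subset _ _) h.disjoint
  feasible := h.feasible
  wt_nonneg := h.wt_nonneg
  wt_none := h.wt_none
  revenueAt_mono S hS := h.revenueAt_mono S
    (hS.trans (Finset.union_subset_union_right (Finset.erase_subset _ _)))
  weights := h.weights
  accepted := h.accepted
  bound := by
    obtain ⟨α, hα0, hα, hfull, hτ⟩ := h.bound
    have heA : e ∉ A := Finset.disjoint_right.1 h.disjoint he
    -- If `e` lost to the lightest offered product, the dual price rises to that weight; if it lost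
    -- to its own product or to free room, `wt e.1` already covers it.
    obtain ⟨β, hαβ, hβ, hβfull, hwβ⟩ : ∃ β, α ≤ β ∧ (∀ i, σ i ≠ none → β ≤ wt i) ∧
        (β = 0 ∨ I.k ≤ (support σ).card) ∧
        (1 ≤ I.k → I.marginal A e ≤ 2 * max β (wt e.1)) := by
      by_cases hk : 1 ≤ I.k
      · rcases hv with ⟨rfl, -⟩ | ⟨-, hcard, hmin⟩
        · exact ⟨α, le_rfl, hα, hfull, fun hk => (hw hk).trans
            (mul_le_mul_of_nonneg_left (le_max_right _ _) zero_le_two)⟩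
        · obtain ⟨hv0, hmin⟩ := hmin hk
          exact ⟨wt v, hα v hv0, hmin, Or.inr hcard, fun hk => (hw hk).trans
            (mul_le_mul_of_nonneg_left (le_max_left _ _) zero_le_two)⟩
      · exact ⟨α, le_rfl, hα, hfull, fun h => absurd h hk⟩
    have hβ0 := hα0.trans hαβ
    refine ⟨β, hβ0, hβ, hβfull, fun τ hf => ?_⟩
    obtain ⟨D, hD, hle⟩ := hτ τ hf
    have hb0 : ∀ i, 0 ≤ 2 * max β (wt i) := fun i =>
      mul_nonneg zero_le_two (le_max_of_le_left hβ0)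
    have hsub : PricedAssortment.offered τ \ (A ∪ U) ⊆
        PricedAssortment.offered τ \ (A ∪ U.erase e) :=
      Finset.sdiff_subset_sdiff le_rfl
        (Finset.union_subset_union_right (Finset.erase_subset _ _))
    have hmono : ∑ d ∈ PricedAssortment.offered τ \ (A ∪ U), 2 * max α (wt d.1) ≤
        ∑ d ∈ PricedAssortment.offered τ \ (A ∪ U), 2 * max β (wt d.1) :=
      Finset.sum_le_sum fun d _ =>
        mul_le_mul_of_nonneg_left (max_le_max_right _ hαβ) zero_le_two
    by_cases heD : e ∈ D
    · have hDU : D ⊆ U := hD.trans Finset.inter_subset_right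
      have heτ : e ∈ PricedAssortment.offered τ := Finset.mem_of_mem_inter_left (hD heD)
      obtain ⟨D', hD', hrev⟩ := I.model.exists_revenue_union_le_erase (fun e => I.price e.2)
        (Finset.disjoint_of_subset_right hDU h.disjoint) heA
      change I.setRevenue (A ∪ D) ≤ I.setRevenue (A ∪ D') + max 0 (I.marginal A e) at hrev
      -- With `k = 0` a rejected pair may have any marginal revenue, but then no feasible `τ`
      -- contains it.
      have hk : 1 ≤ I.k := by
        refine le_trans (Finset.card_pos.2 ⟨e.1, ?_⟩) hf
        simp [mem_offered.1 heτ]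
      refine ⟨D', fun d hd => ?_, ?_⟩
      · have h1 := Finset.mem_erase.1 (hD' hd)
        have h2 := Finset.mem_inter.1 (hD h1.2)
        exact Finset.mem_inter.2 ⟨h2.1, Finset.mem_erase.2 ⟨h1.1, h2.2⟩⟩
      · have heq : PricedAssortment.offered τ \ (A ∪ U.erase e) =
            insert e (PricedAssortment.offered τ \ (A ∪ U)) := by
          ext d
          simp only [mem_sdiff, mem_union, mem_erase, mem_insert]
          by_cases hde : d = e
          · subst hde; tauto
          · tauto
        rw [heq, Finset.sum_insert (by simp [he])]
        have := max_le (hb0 e.1) (hwβ hk)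
        linarith
    · refine ⟨D, fun d hd => ?_, ?_⟩
      · have h2 := Finset.mem_inter.1 (hD hd)
        exact Finset.mem_inter.2 ⟨h2.1, Finset.mem_erase.2 ⟨fun h => heD (h ▸ hd), h2.2⟩⟩
      · have := Finset.sum_le_sum_of_subset_of_nonneg hsub
          (f := fun d => 2 * max β (wt d.1)) fun d _ _ => hb0 d.1
        linarith

/-- The assortment after `v` has been replaced by `e`. -/
def exchange (σ : PricedAssortment n r) (v : Fin n) (e : Fin n × Fin r) : PricedAssortment n r :=
  Function.update (Function.update σ v none) e.1 (some e.2)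

theorem support_exchange (σ : PricedAssortment n r) (v : Fin n) (e : Fin n × Fin r) :
    support (exchange σ v e) = insert e.1 ((support σ).erase v) := by
  ext i
  by_cases h : i = e.1
  · simp [mem_support, exchange, h]
  · by_cases h' : i = v
    · subst h'; simp [mem_support, exchange, h]
    · simp [mem_support, exchange, h, h']

/-- Accepting the pair with the largest adjusted price. -/
theorem Invariant.accept {I : PricingInstance n r} {σ : PricedAssortment n r} {wt : Fin n → ℝ}
    {A U : Finset (Fin n × Fin r)} (h : I.Invariant σ wt A U) {e : Fin n × Fin r} (he : e ∈ U)
    (hmax : ∀ d ∈ U, I.adjustedPrice A d ≤ I.adjustedPrice A e)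
    {v : Fin n} (hv : I.IsVictim σ wt e.1 v) (hk : 1 ≤ I.k) (hw : 2 * wt v < I.marginal A e) :
    I.Invariant (exchange σ v e) (Function.update (Function.update wt v 0) e.1 (I.marginal A e))
      (insert e A) (U.erase e) := by
  have heA : e ∉ A := Finset.disjoint_right.1 h.disjoint he
  set w := I.marginal A e with hwdef
  have hw0 : 0 < w := lt_of_le_of_lt (mul_nonneg zero_le_two (h.wt_nonneg v)) hw
  have hadj : 0 ≤ I.adjustedPrice A e := by
    by_contra hneg
    exact absurd hw0 (not_lt.2 (mul_nonpos_of_nonneg_of_nonpos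
      (I.model.choiceProb_nonneg _ _) (not_le.1 hneg).le))
  have hAU : insert e A ∪ U.erase e = A ∪ U := by
    rw [Finset.insert_union, ← Finset.union_insert, Finset.insert_erase he]
  -- Here the order of examination matters: enlarging `A` by unexamined pairs earns at most the
  -- largest adjusted price, which is that of `e`, and `R_e(A)` plus this is `p_e`.
  have hgain : ∀ S, A ⊆ S → S ⊆ A ∪ U → I.revenueAt S e ≤ I.price e.2 := by
    intro S hAS hSU
    have hle := (I.model.startAt e).revenue_union_le (fun e => I.price e.2)
      (Finset.disjoint_sdiff (s := A) (t := S)) hadj fun c hc => hmax c (by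
        have h1 := Finset.mem_sdiff.1 hc
        exact (Finset.mem_union.1 (hSU h1.1)).resolve_left h1.2)
    rw [Finset.union_sdiff_of_subset hAS] at hle
    change I.revenueAt S e ≤ I.revenueAt A e + I.adjustedPrice A e at hle
    unfold adjustedPrice at hle
    linarith
  set wt' : Fin n → ℝ := Function.update (Function.update wt v 0) e.1 w with hwt'
  have hwte : wt' e.1 = w := by simp [hwt']
  have hwtv : v ≠ e.1 → wt' v = 0 := fun hve => by simp [hwt', hve]
  have hwto : ∀ i, i ≠ e.1 → i ≠ v → wt' i = wt i := fun i h1 h2 => by simp [hwt', h1, h2]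
  have hσe : exchange σ v e e.1 = some e.2 := by simp [exchange]
  have hσv : v ≠ e.1 → exchange σ v e v = none := fun hve => by simp [exchange, hve]
  have hσo : ∀ i, i ≠ e.1 → i ≠ v → exchange σ v e i = σ i :=
    fun i h1 h2 => by simp [exchange, h1, h2]
  have hsome : ∀ i, exchange σ v e i ≠ none → i = e.1 ∨ (i ≠ e.1 ∧ i ≠ v ∧ σ i ≠ none) := by
    intro i hi
    by_cases h1 : i = e.1
    · exact Or.inl h1
    · have h2 : i ≠ v := fun h2 => hi (h2 ▸ hσv (h2 ▸ h1))
      exact Or.inr ⟨h1, h2, by rwa [hσo i h1 h2] at hi⟩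
  have hcard : (support (exchange σ v e)).card ≤ I.k ∧
      (I.k ≤ (support σ).card → I.k ≤ (support (exchange σ v e)).card) := by
    rw [support_exchange]
    rcases hv with ⟨rfl, hoff | hlt⟩ | ⟨hnone, hfull, hmin⟩
    · rw [Finset.insert_erase (mem_support.2 hoff)]
      exact ⟨h.feasible, id⟩
    · rw [Finset.card_insert_of_notMem (Finset.notMem_erase _ _)]
      have := Finset.card_erase_le (s := support σ) (a := e.1)
      exact ⟨by omega, fun hge => by omega⟩
    · have hvs := mem_support.2 (hmin hk).1
      have hes : e.1 ∉ (support σ).erase v := fun hmem =>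
        mem_support.1 (Finset.mem_of_mem_erase hmem) hnone
      rw [Finset.card_insert_of_notMem hes, Finset.card_erase_of_mem hvs]
      have := Finset.card_pos.2 ⟨v, hvs⟩
      have := h.feasible
      exact ⟨by omega, fun _ => by omega⟩
  refine ⟨?_, ?_, hcard.1, ?_, ?_, ?_, ?_, ?_, ?_⟩
  · intro d hd
    rw [mem_offered] at hd
    rcases hsome d.1 (by rw [hd]; simp) with h1 | ⟨h1, h2, -⟩
    · rw [h1, hσe] at hd
      exact Finset.mem_insert.2 (Or.inl (Prod.ext h1 (Option.some.inj hd).symm))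
    · rw [hσo _ h1 h2] at hd
      exact Finset.mem_insert_of_mem (h.offered_subset (mem_offered.2 hd))
  · rw [Finset.disjoint_insert_left]
    exact ⟨Finset.notMem_erase _ _,
      Finset.disjoint_of_subset_right (Finset.erase_subset _ _) h.disjoint⟩
  · intro i
    by_cases h1 : i = e.1
    · rw [h1, hwte]; exact hw0.le
    · by_cases h2 : i = v
      · rw [h2, hwtv (h2 ▸ h1)]
      · rw [hwto i h1 h2]; exact h.wt_nonneg i
  · intro i hi
    by_cases h1 : i = e.1
    · rw [h1, hσe] at hi; simp at hi
    · by_cases h2 : i = v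
      · rw [h2, hwtv (h2 ▸ h1)]
      · rw [hσo i h1 h2] at hi
        rw [hwto i h1 h2, h.wt_none i hi]
  · intro S hS d
    rw [hAU] at hS
    refine (h.revenueAt_mono S hS d).trans ?_
    rw [Finset.union_insert]
    exact (I.model.startAt d).revenue_le_insert _
      (hgain _ Finset.subset_union_right (Finset.union_subset hS Finset.subset_union_left))
  · obtain ⟨ω, hω, hωσ⟩ := h.weights
    refine ⟨Function.update ω e w, fun S hS => ?_, fun i p hip => ?_⟩
    · by_cases heS : e ∈ S
      · have hSe : S.erase e ⊆ A := fun d hd =>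
          (Finset.mem_insert.1 (hS (Finset.mem_of_mem_erase hd))).resolve_left
            (Finset.ne_of_mem_erase hd)
        rw [← Finset.insert_erase heS, Finset.sum_insert (Finset.notMem_erase _ _),
          Function.update_self, Finset.sum_congr rfl fun d hd => by
            rw [Function.update_of_ne (Finset.ne_of_mem_erase hd)]]
        have h1 := I.model.revenue_insert (fun e => I.price e.2) (Finset.notMem_erase e S)
        change I.setRevenue _ = I.setRevenue _ +
          _ * (I.price e.2 - I.revenueAt (S.erase e) e) at h1
        have h2 := hω _ hSe
        -- The marginal revenue against `A` is at most that against a subset: the choice probability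
        -- grows and, by `revenueAt_mono`, the forgone revenue shrinks.
        have h3 : w ≤ I.model.choiceProb e (insert e (S.erase e)) *
            (I.price e.2 - I.revenueAt (S.erase e) e) := by
          have hm := h.revenueAt_mono _ (hSe.trans Finset.subset_union_left) e
          rw [Finset.union_eq_right.2 hSe] at hm
          exact mul_le_mul (I.model.choiceProb_anti (Finset.insert_subset_insert _ hSe)
            (Finset.mem_insert_self _ _)) (sub_le_sub_left hm _) hadj
            (I.model.choiceProb_nonneg _ _)
        linarith
      · rw [Finset.sum_congr rfl fun d hd => by
          rw [Function.update_of_ne (show d ≠ e from fun hde => heS (by rwa [← hde]))]]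
        exact hω S fun d hd => (Finset.mem_insert.1 (hS hd)).resolve_left
          fun hde => heS (by rwa [← hde])
    · rcases hsome i (by rw [hip]; simp) with h1 | ⟨h1, h2, -⟩
      · subst h1
        rw [hσe] at hip
        rw [hwte, ← Option.some.inj hip, Function.update_self]
      · rw [hσo i h1 h2] at hip
        rw [hwto i h1 h2, Function.update_of_ne (fun hde => h1 (congrArg Prod.fst hde)),
          hωσ i p hip]
  · have h1 := I.model.revenue_insert (fun e => I.price e.2) heA
    change I.setRevenue _ = I.setRevenue A + w at h1
    -- Hence the total weight changes by exactly `w - wt v`, which is at least `w / 2`, whereas the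
    -- revenue of the accepted set grows by `w`.
    have hwe : Function.update wt v 0 e.1 = 0 := by
      by_cases hve : e.1 = v
      · rw [hve, Function.update_self]
      · rw [Function.update_of_ne hve]
        rcases hv with ⟨h2, -⟩ | ⟨h2, -⟩
        · exact absurd h2.symm hve
        · exact h.wt_none _ h2
    have hs1 : ∑ i, wt' i = w + ∑ i ∈ univ.erase e.1, Function.update wt v 0 i := by
      rw [hwt', Finset.sum_update_of_mem (Finset.mem_univ _), ← Finset.erase_eq]
    have hs2 := Finset.add_sum_erase univ (Function.update wt v 0) (Finset.mem_univ e.1)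
    have hs3 : ∑ i, Function.update wt v 0 i = 0 + ∑ i ∈ univ.erase v, wt i := by
      rw [Finset.sum_update_of_mem (Finset.mem_univ _), ← Finset.erase_eq]
    have hs4 := Finset.add_sum_erase univ wt (Finset.mem_univ v)
    have := h.accepted
    rw [h1, hs1]
    linarith
  · obtain ⟨α, hα0, hα, hfull, hτ⟩ := h.bound
    -- A product that leaves has its weight reset to zero, so the dual price takes over this weight.
    -- Thus `max α (wt i)` never decreases and earlier charges remain paid.
    obtain ⟨β, hαβ, hβ, hβfull, hmono⟩ : ∃ β, α ≤ β ∧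
        (∀ i, exchange σ v e i ≠ none → β ≤ wt' i) ∧
        (β = 0 ∨ I.k ≤ (support (exchange σ v e)).card) ∧
        ∀ i, max α (wt i) ≤ max β (wt' i) := by
      rcases hv with ⟨rfl, hoff⟩ | ⟨hnone, hcardge, hmin⟩
      · have hαw : α ≤ w := by
          rcases hoff with hoff | hlt
          · have := hα _ hoff
            have := h.wt_nonneg e.1
            linarith
          · rw [hfull.resolve_right (not_le.2 hlt)]
            exact hw0.le
        refine ⟨α, le_rfl, fun i hi => ?_, hfull.imp_right hcard.2, fun i => ?_⟩
        · rcases hsome i hi with h1 | ⟨h1, h2, h3⟩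
          · rw [h1, hwte]; exact hαw
          · rw [hwto i h1 h2]; exact hα i h3
        · by_cases h1 : i = e.1
          · rw [h1, hwte]
            have := h.wt_nonneg e.1
            exact max_le_max_left _ (by linarith)
          · rw [hwto i h1 h1]
      · obtain ⟨hv0, hmin⟩ := hmin hk
        have hve : v ≠ e.1 := fun h1 => hv0 (h1 ▸ hnone)
        have hwtv0 := h.wt_nonneg v
        refine ⟨wt v, hα v hv0, fun i hi => ?_, Or.inr (hcard.2 hcardge), fun i => ?_⟩
        · rcases hsome i hi with h1 | ⟨h1, h2, h3⟩
          · rw [h1, hwte]; linarith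
          · rw [hwto i h1 h2]; exact hmin i h3
        · by_cases h1 : i = e.1
          · rw [h1, hwte, h.wt_none _ hnone]
            exact max_le_max (hα v hv0) hw0.le
          · by_cases h2 : i = v
            · rw [h2]
              exact max_le (le_max_of_le_left (hα v hv0)) (le_max_left _ _)
            · rw [hwto i h1 h2]
              exact max_le_max_right _ (hα v hv0)
    refine ⟨β, hα0.trans hαβ, hβ, hβfull, fun τ hf => ?_⟩
    obtain ⟨D, hD, hle⟩ := hτ τ hf
    have hDU : D ⊆ U := hD.trans Finset.inter_subset_right
    refine ⟨D.erase e, fun d hd => ?_, ?_⟩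
    · have h1 := Finset.mem_erase.1 hd
      have h2 := Finset.mem_inter.1 (hD h1.2)
      exact Finset.mem_inter.2 ⟨h2.1, Finset.mem_erase.2 ⟨h1.1, h2.2⟩⟩
    · have heq : insert e A ∪ D.erase e = insert e (A ∪ D) := by
        ext d
        simp only [mem_union, mem_insert, mem_erase]
        by_cases hde : d = e <;> simp [hde]
      rw [hAU, heq]
      have h1 : I.setRevenue (A ∪ D) ≤ I.setRevenue (insert e (A ∪ D)) :=
        I.model.revenue_le_insert _ (hgain _ Finset.subset_union_left
          (Finset.union_subset_union_right hDU))
      have h2 : ∑ d ∈ PricedAssortment.offered τ \ (A ∪ U), 2 * max α (wt d.1) ≤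
          ∑ d ∈ PricedAssortment.offered τ \ (A ∪ U), 2 * max β (wt' d.1) :=
        Finset.sum_le_sum fun d _ => mul_le_mul_of_nonneg_left (hmono d.1) zero_le_two
      linarith

/-- Weak duality: `α` prices the cardinality bound, and `wt i - α` the product `i`. -/
theorem sum_max_le_sum {I : PricingInstance n r} {σ τ : PricedAssortment n r} {wt : Fin n → ℝ}
    {α : ℝ} (hα0 : 0 ≤ α) (hα : ∀ i, σ i ≠ none → α ≤ wt i) (hnone : ∀ i, σ i = none → wt i = 0)
    (hfull : α = 0 ∨ I.k ≤ (support σ).card) (hτ : I.Feasible τ) :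
    ∑ i ∈ support τ, max α (wt i) ≤ ∑ i, wt i := by
  -- Summed over `τ`, the first part is at most `α` times the size of `σ`, by the tightness of the
  -- bound or because `α = 0`; the second is at most its sum over `σ`.
  have hpt : ∀ i, max α (wt i) = α + if i ∈ support σ then wt i - α else 0 := by
    intro i
    by_cases hi : σ i = none
    · rw [if_neg (by simp [mem_support, hi]), hnone i hi, max_eq_left hα0, add_zero]
    · rw [if_pos (mem_support.2 hi), max_eq_right (hα i hi)]
      ring
  have hwt : ∑ i, wt i = ∑ i ∈ support σ, wt i := by
    refine (Finset.sum_subset (Finset.subset_univ _) fun i _ hi => hnone i ?_).symm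
    simpa [mem_support] using hi
  have h1 : ∑ i ∈ support τ, (if i ∈ support σ then wt i - α else 0) ≤
      ∑ i ∈ support σ, (wt i - α) := by
    rw [← Finset.sum_filter]
    refine Finset.sum_le_sum_of_subset_of_nonneg (fun i hi => (Finset.mem_filter.1 hi).2)
      fun i hi _ => sub_nonneg.2 (hα i (mem_support.1 hi))
  rw [Finset.sum_congr rfl fun i _ => hpt i, Finset.sum_add_distrib, Finset.sum_const,
    nsmul_eq_mul, hwt]
  rw [Finset.sum_sub_distrib, Finset.sum_const, nsmul_eq_mul] at h1
  rcases hfull with h0 | hfull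
  · simp only [h0, mul_zero, sub_zero, zero_add] at h1 ⊢
    exact h1
  · have hle : ((support τ).card : ℝ) * α ≤ (support σ).card * α := by
      exact mul_le_mul_of_nonneg_right (Nat.cast_le.2 (le_trans hτ hfull)) hα0
    linarith

/-- Once nothing is unexamined, `D` is empty, and the revenue of `τ` splits into the revenue of `A`
and the charges, each at most twice the total weight. A priced assortment has one pair per product,
so sums over pairs become sums over products. -/
theorem Invariant.quarter_le {I : PricingInstance n r} {σ : PricedAssortment n r}
    {wt : Fin n → ℝ} {A : Finset (Fin n × Fin r)} (h : I.Invariant σ wt A ∅)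
    (τ : PricedAssortment n r) (hτ : I.Feasible τ) :
    (1 / 4 : ℝ) * I.revenue τ ≤ I.revenue σ := by
  obtain ⟨ω, hω, hωσ⟩ := h.weights
  obtain ⟨α, hα0, hα, hfull, hbound⟩ := h.bound
  obtain ⟨D, hD, hle⟩ := hbound τ hτ
  have hD0 : D = ∅ := by simpa using hD
  rw [hD0, Finset.union_empty] at hle
  have hinj : ∀ ρ : PricedAssortment n r,
      Set.InjOn Prod.fst (PricedAssortment.offered ρ : Set (Fin n × Fin r)) := by
    intro ρ d hd d' hd' hdd
    have h1 := mem_offered.1 hd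
    have h2 := mem_offered.1 hd'
    rw [hdd, h2] at h1
    exact Prod.ext hdd (Option.some.inj h1).symm
  have himage : ∀ ρ : PricedAssortment n r,
      (PricedAssortment.offered ρ).image Prod.fst = support ρ := by
    intro ρ
    ext i
    simp only [Finset.mem_image, mem_offered, mem_support, Option.ne_none_iff_exists']
    exact ⟨fun ⟨d, h1, h2⟩ => ⟨d.2, h2 ▸ h1⟩, fun ⟨p, hp⟩ => ⟨(i, p), hp, rfl⟩⟩
  have hb0 : ∀ i, 0 ≤ 2 * max α (wt i) := fun i =>
    mul_nonneg zero_le_two (le_max_of_le_left hα0)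
  have h1 : ∑ e ∈ PricedAssortment.offered τ \ A, 2 * max α (wt e.1) ≤
      2 * ∑ i ∈ support τ, max α (wt i) := by
    rw [Finset.mul_sum, ← himage, Finset.sum_image (hinj τ)]
    exact Finset.sum_le_sum_of_subset_of_nonneg Finset.sdiff_subset fun e _ _ => hb0 e.1
  have h2 := sum_max_le_sum hα0 hα h.wt_none hfull hτ
  have h3 : ∑ i, wt i ≤ I.revenue σ := by
    refine le_trans (le_of_eq ?_) (hω _ h.offered_subset)
    rw [← Finset.sum_subset (Finset.subset_univ (support σ)) fun i _ hi => h.wt_none i (by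
      simpa [mem_support] using hi), ← himage, Finset.sum_image (hinj σ)]
    exact Finset.sum_congr rfl fun e he => hωσ _ _ (mem_offered.1 he)
  have h4 := h.accepted
  change I.revenue τ ≤ _ at hle
  linarith

end PricingInstance

/-! ### A loop language with a denotational semantics -/

namespace RealRAM

namespace Store

@[simp] theorem setNat_nat (s : Store) (a : ℕ) (l : List ℕ) (v : ℕ) (b : ℕ) (m : List ℕ) :
    (s.setNat a l v).nat b m = if b = a then if m = l then v else s.nat b m else s.nat b m := by
  by_cases h : b = a
  · subst h
    simp [setNat, Function.update_apply]
  · simp [setNat, h]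

@[simp] theorem setNat_real (s : Store) (a : ℕ) (l : List ℕ) (v : ℕ) :
    (s.setNat a l v).real = s.real := rfl

@[simp] theorem setReal_nat (s : Store) (a : ℕ) (l : List ℕ) (v : ℝ) :
    (s.setReal a l v).nat = s.nat := rfl

@[simp] theorem setReal_real (s : Store) (a : ℕ) (l : List ℕ) (v : ℝ) (b : ℕ) (m : List ℕ) :
    (s.setReal a l v).real b m =
      if b = a then if m = l then v else s.real b m else s.real b m := by
  by_cases h : b = a
  · subst h
    simp [setReal, Function.update_apply]
  · simp [setReal, h]

theorem setNat_nat_of_ne (s : Store) {a b : ℕ} (l : List ℕ) (v : ℕ) (h : b ≠ a) :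
    (s.setNat a l v).nat b = s.nat b := by
  simp [setNat, h]

theorem setReal_real_of_ne (s : Store) {a b : ℕ} (l : List ℕ) (v : ℝ) (h : b ≠ a) :
    (s.setReal a l v).real b = s.real b := by
  simp [setReal, h]

end Store

/-- Programs whose only loops are `for v = 0, …, N - 1`, with a scalar variable `N`. -/
inductive Cmd where
  | skip
  | setNat (a : ℕ) (ix : List ℕ) (e : NatExpr)
  | setReal (a : ℕ) (ix : List ℕ) (e : RealExpr)
  | seq (c d : Cmd)
  | ite (b : Test) (c d : Cmd)
  | loop (v N : ℕ) (c : Cmd)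

namespace Cmd

def loopTest (v N : ℕ) : Test := .not (.natLe (.read N []) (.read v []))

def toProg : Cmd → Prog
  | skip => .skip
  | setNat a ix e => .setNat a ix e
  | setReal a ix e => .setReal a ix e
  | seq c d => .seq c.toProg d.toProg
  | ite b c d => .ite b c.toProg d.toProg
  | loop v N c => .seq (.setNat v [] (.lit 0))
      (.while (loopTest v N) (.seq c.toProg (.setNat v [] (.add (.read v []) (.lit 1)))))

open scoped Classical in
noncomputable def run : Cmd → Store → Store
  | skip, s => s
  | setNat a ix e, s => s.setNat a (s.addr ix) (e.eval s)
  | setReal a ix e, s => s.setReal a (s.addr ix) (e.eval s)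
  | seq c d, s => d.run (c.run s)
  | ite b c d, s => if b.Holds s then c.run s else d.run s
  | loop v N c, s =>
      (Nat.rec (motive := fun _ => Store) s (fun k s' => c.run (s'.setNat v [] k))
        (s.nat N [])).setNat v [] (s.nat N [])

/-- The natural number arrays that are written. -/
def natWrites : Cmd → List ℕ
  | skip => []
  | setNat a _ _ => [a]
  | setReal _ _ _ => []
  | seq c d => c.natWrites ++ d.natWrites
  | ite _ c d => c.natWrites ++ d.natWrites
  | loop v _ c => v :: c.natWrites

/-- The real arrays that are written. -/
def realWrites : Cmd → List ℕ
  | skip => []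
  | setNat _ _ _ => []
  | setReal a _ _ => [a]
  | seq c d => c.realWrites ++ d.realWrites
  | ite _ c d => c.realWrites ++ d.realWrites
  | loop _ _ c => c.realWrites

/-- The arrays `0` and `1` are never written, and all loops are bounded by one of them. -/
def wellFormed : Cmd → Bool
  | skip => true
  | setNat a _ _ => 2 ≤ a
  | setReal _ _ _ => true
  | seq c d => c.wellFormed && d.wellFormed
  | ite _ c d => c.wellFormed && d.wellFormed
  | loop v N c => 2 ≤ v && N ≤ 1 && !c.natWrites.contains v && c.wellFormed

/-- A bound for the running time in terms of the sum of the scalars `0` and `1`. -/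
noncomputable def time : Cmd → Polynomial ℕ
  | skip => 1
  | setNat _ ix e => Polynomial.C (1 + ix.length + e.cost)
  | setReal _ ix e => Polynomial.C (1 + ix.length + e.cost)
  | seq c d => c.time + d.time
  | ite b c d => Polynomial.C b.cost + (c.time + d.time)
  | loop v N c => Polynomial.C (2 + (loopTest v N).cost) +
      Polynomial.X * (Polynomial.C ((loopTest v N).cost + 4) + c.time)

/-- `s` and `s'` differ at most in the arrays that `c` writes. -/
def Agree (c : Cmd) (s s' : Store) : Prop :=
  (∀ a ∉ c.natWrites, s'.nat a = s.nat a) ∧ ∀ a ∉ c.realWrites, s'.real a = s.real a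

/-- The frame rule. The write sets are syntactic, so that untouched arrays can be dealt with by
`decide`. -/
theorem agree_run (c : Cmd) (s : Store) : c.Agree s (c.run s) := by
  induction c generalizing s with
  | skip => exact ⟨fun _ _ => rfl, fun _ _ => rfl⟩
  | setNat a ix e =>
    refine ⟨fun b hb => s.setNat_nat_of_ne _ _ ?_, fun _ _ => rfl⟩
    simpa [natWrites] using hb
  | setReal a ix e =>
    refine ⟨fun _ _ => rfl, fun b hb => s.setReal_real_of_ne _ _ ?_⟩
    simpa [realWrites] using hb
  | seq c d hc hd =>
    refine ⟨fun a ha => ?_, fun a ha => ?_⟩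
    · simp only [natWrites, List.mem_append, not_or] at ha
      rw [run, (hd _).1 a ha.2, (hc _).1 a ha.1]
    · simp only [realWrites, List.mem_append, not_or] at ha
      rw [run, (hd _).2 a ha.2, (hc _).2 a ha.1]
  | ite b c d hc hd =>
    refine ⟨fun a ha => ?_, fun a ha => ?_⟩
    · simp only [natWrites, List.mem_append, not_or] at ha
      rw [run]
      split_ifs
      · exact (hc _).1 a ha.1
      · exact (hd _).1 a ha.2
    · simp only [realWrites, List.mem_append, not_or] at ha
      rw [run]
      split_ifs
      · exact (hc _).2 a ha.1
      · exact (hd _).2 a ha.2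
  | loop v N c hc =>
    rw [run]
    generalize s.nat N [] = m
    refine ⟨fun a ha => ?_, fun a ha => ?_⟩
    · simp only [natWrites, List.mem_cons, not_or] at ha
      rw [Store.setNat_nat_of_ne _ _ _ ha.1]
      induction m with
      | zero => rfl
      | succ m ih => rw [(hc _).1 a ha.2, Store.setNat_nat_of_ne _ _ _ ha.1, ih]
    · rw [Store.setNat_real]
      induction m with
      | zero => rfl
      | succ m ih => rw [(hc _).2 a ha, Store.setNat_real, ih]

theorem two_le_of_mem_natWrites {c : Cmd} (hc : c.wellFormed) {a : ℕ} (ha : a ∈ c.natWrites) :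
    2 ≤ a := by
  induction c with
  | skip => simp [natWrites] at ha
  | setNat b ix e =>
    simp only [natWrites, List.mem_singleton] at ha
    simpa [wellFormed, ha] using hc
  | setReal b ix e => simp [natWrites] at ha
  | seq c d hc' hd' =>
    simp only [wellFormed, Bool.and_eq_true] at hc
    simp only [natWrites, List.mem_append] at ha
    exact ha.elim (hc' hc.1) (hd' hc.2)
  | ite b c d hc' hd' =>
    simp only [wellFormed, Bool.and_eq_true] at hc
    simp only [natWrites, List.mem_append] at ha
    exact ha.elim (hc' hc.1) (hd' hc.2)
  | loop v N c hc' =>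
    simp only [wellFormed, Bool.and_eq_true, decide_eq_true_eq] at hc
    simp only [natWrites, List.mem_cons] at ha
    rcases ha with rfl | ha
    · exact hc.1.1.1
    · exact hc' hc.2 ha

theorem run_nat_of_le_one {c : Cmd} (hc : c.wellFormed) (s : Store) {a : ℕ} (ha : a ≤ 1) :
    (c.run s).nat a = s.nat a :=
  (c.agree_run s).1 a fun h => by have := two_le_of_mem_natWrites hc h; omega

/-- The scalars `0` and `1` never change, so the same `m` bounds the iterations of every loop at
every depth, and nested loops merely multiply polynomials. -/
theorem exec_run {c : Cmd} (hc : c.wellFormed) (s : Store) (m : ℕ)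
    (hm : s.nat 0 [] + s.nat 1 [] = m) :
    ∃ t ≤ c.time.eval m, Exec c.toProg s t (c.run s) := by
  induction c generalizing s with
  | skip => exact ⟨1, by simp [time], Exec.skip s⟩
  | setNat a ix e => exact ⟨_, by simp [time], Exec.setNat a ix e s⟩
  | setReal a ix e => exact ⟨_, by simp [time], Exec.setReal a ix e s⟩
  | seq c d hc' hd' =>
    simp only [wellFormed, Bool.and_eq_true] at hc
    obtain ⟨t, ht, h1⟩ := hc' hc.1 s hm
    obtain ⟨u, hu, h2⟩ := hd' hc.2 (c.run s) (by
      rwa [run_nat_of_le_one hc.1 s zero_le_one, run_nat_of_le_one hc.1 s le_rfl])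
    exact ⟨t + u, by simpa [time] using Nat.add_le_add ht hu, Exec.seq h1 h2⟩
  | ite b c d hc' hd' =>
    simp only [wellFormed, Bool.and_eq_true] at hc
    rw [run]
    split_ifs with hb
    · obtain ⟨t, ht, h1⟩ := hc' hc.1 s hm
      refine ⟨b.cost + t, ?_, Exec.ite_true hb h1⟩
      simp only [time, Polynomial.eval_add, Polynomial.eval_C]
      omega
    · obtain ⟨t, ht, h1⟩ := hd' hc.2 s hm
      refine ⟨b.cost + t, ?_, Exec.ite_false hb h1⟩
      simp only [time, Polynomial.eval_add, Polynomial.eval_C]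
      omega
  | loop v N c hc' =>
    simp only [wellFormed, Bool.and_eq_true, decide_eq_true_eq, Bool.not_eq_true',
      List.contains_eq_mem, decide_eq_false_iff_not] at hc
    obtain ⟨⟨⟨hv, hN⟩, hvc⟩, hwf⟩ := hc
    -- The store after `k` rounds, before the counter is updated; at the head of the `while` loop
    -- the store is `(Y k).setNat v [] k`.
    set Y : ℕ → Store := fun k =>
      Nat.rec (motive := fun _ => Store) s (fun k s' => c.run (s'.setNat v [] k)) k with hY
    have hYsucc : ∀ k, Y (k + 1) = c.run ((Y k).setNat v [] k) := fun k => rfl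
    have hYnat : ∀ k a, a ≤ 1 → (Y k).nat a = s.nat a := by
      intro k a ha
      induction k with
      | zero => rfl
      | succ k ih =>
        rw [hYsucc, run_nat_of_le_one hwf _ ha, Store.setNat_nat_of_ne _ _ _ (by omega), ih]
    set B := (loopTest v N).cost with hB
    set T := c.time.eval m with hT
    have hHolds : ∀ k, (loopTest v N).Holds ((Y k).setNat v [] k) ↔ k < s.nat N [] := by
      intro k
      have hNv : N ≠ v := by omega
      simp [loopTest, Test.Holds, NatExpr.eval, Store.addr, hNv, hYnat k N hN]
    have hwhile : ∀ d k, k + d = s.nat N [] → ∃ t ≤ d * (B + (4 + T)) + B,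
        Exec (.while (loopTest v N) (.seq c.toProg
          (.setNat v [] (.add (.read v []) (.lit 1))))) ((Y k).setNat v [] k) t
          ((Y (s.nat N [])).setNat v [] (s.nat N [])) := by
      intro d
      induction d with
      | zero =>
        intro k hk
        obtain rfl : k = s.nat N [] := hk
        exact ⟨B, by omega, Exec.while_false (by rw [hHolds]; omega)⟩
      | succ d ih =>
        intro k hk
        obtain ⟨t, ht, h1⟩ := hc' hwf ((Y k).setNat v [] k) (by
          rw [Store.setNat_nat_of_ne _ _ _ (by omega), Store.setNat_nat_of_ne _ _ _ (by omega),
            hYnat _ _ zero_le_one, hYnat _ _ le_rfl, hm])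
        obtain ⟨u, hu, h2⟩ := ih (k + 1) (by omega)
        have h3 := Exec.setNat v [] (.add (.read v []) (.lit 1)) (c.run ((Y k).setNat v [] k))
        have hval : (NatExpr.add (.read v []) (.lit 1)).eval
            (c.run ((Y k).setNat v [] k)) = k + 1 := by
          have := (c.agree_run ((Y k).setNat v [] k)).1 v hvc
          simp [NatExpr.eval, Store.addr, this]
        rw [hval] at h3
        refine ⟨_, ?_, Exec.while_true ((hHolds k).2 (by omega)) (Exec.seq h1 h3) h2⟩
        simp only [List.length_nil, NatExpr.cost]
        rw [← hB]
        have : (d + 1) * (B + (4 + T)) = d * (B + (4 + T)) + (B + (4 + T)) := by ring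
        omega
    obtain ⟨t, ht, hex⟩ := hwhile (s.nat N []) 0 (by omega)
    refine ⟨_, ?_, Exec.seq (Exec.setNat v [] (.lit 0) s) hex⟩
    have hNm : s.nat N [] ≤ m := by
      have : N = 0 ∨ N = 1 := by omega
      rcases this with rfl | rfl <;> omega
    have hmul := Nat.mul_le_mul_right (B + (4 + T)) hNm
    simp only [time, Polynomial.eval_add, Polynomial.eval_mul, Polynomial.eval_C,
      Polynomial.eval_X, List.length_nil, NatExpr.cost]
    rw [← hB, ← hT, add_assoc B 4 T]
    omega

theorem agree_refl (c : Cmd) (s : Store) : c.Agree s s := ⟨fun _ _ => rfl, fun _ _ => rfl⟩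

theorem Agree.trans {c : Cmd} {s s' s'' : Store} (h : c.Agree s s') (h' : c.Agree s' s'') :
    c.Agree s s'' :=
  ⟨fun a ha => (h'.1 a ha).trans (h.1 a ha), fun a ha => (h'.2 a ha).trans (h.2 a ha)⟩

/-- Invariant rule for loops over `Fin n`. -/
theorem run_loop {n v N : ℕ} {c : Cmd} {s : Store} (hN : s.nat N [] = n)
    (Inv : Finset (Fin n) → Store → Prop)
    (hstable : ∀ D s x, Inv D s → Inv D (s.setNat v [] x)) (h0 : Inv ∅ s)
    (hstep : ∀ D (i : Fin n) s', i ∉ D → (loop v N c).Agree s s' → s'.nat v [] = (i : ℕ) → Inv D s' →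
      Inv (insert i D) (c.run s')) :
    Inv Finset.univ ((loop v N c).run s) := by
  rw [run, hN]
  refine hstable _ _ _ ?_
  set Y : ℕ → Store := fun k =>
    Nat.rec (motive := fun _ => Store) s (fun k s' => c.run (s'.setNat v [] k)) k with hY
  have hset : ∀ s' x, (loop v N c).Agree s' (s'.setNat v [] x) := fun s' x =>
    ⟨fun a ha => Store.setNat_nat_of_ne _ _ _ (by
      simp only [natWrites, List.mem_cons, not_or] at ha; exact ha.1), fun _ _ => rfl⟩
  have hrun : ∀ s', (loop v N c).Agree s' (c.run s') := fun s' =>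
    ⟨fun a ha => (c.agree_run s').1 a (by
      simp only [natWrites, List.mem_cons, not_or] at ha; exact ha.2),
      fun a ha => (c.agree_run s').2 a ha⟩
  have key : ∀ k ≤ n, (loop v N c).Agree s (Y k) ∧
      Inv (Finset.univ.filter fun i : Fin n => (i : ℕ) < k) (Y k) := by
    intro k
    induction k with
    | zero => exact fun _ => ⟨agree_refl _ _, by simpa [hY] using h0⟩
    | succ k ih =>
      intro hk
      obtain ⟨h1, h2⟩ := ih (by omega)
      have h3 := h1.trans (hset _ k)
      refine ⟨h3.trans (hrun _), ?_⟩
      have h4 := hstep _ ⟨k, by omega⟩ _ (by simp) h3 (by simp) (hstable _ _ k h2)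
      convert h4 using 1
      ext i
      simp only [Finset.mem_filter, Finset.mem_univ, true_and, Finset.mem_insert, Fin.ext_iff]
      omega
  have := (key n le_rfl).2
  rwa [Finset.filter_true_of_mem fun i _ => i.2] at this

/-- A loop over all pairs below the scalars `0` and `1`. -/
def loopPair (v w : ℕ) (c : Cmd) : Cmd := loop v 0 (loop w 1 c)

/-- Invariant rule for loops over `Fin n × Fin r`. -/
theorem run_loopPair {n r v w : ℕ} {c : Cmd} {s : Store} (hwf : (loopPair v w c).wellFormed)
    (hn : s.nat 0 [] = n) (hr : s.nat 1 [] = r)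
    (Inv : Finset (Fin n × Fin r) → Store → Prop)
    (hv : ∀ D s x, Inv D s → Inv D (s.setNat v [] x))
    (hw : ∀ D s x, Inv D s → Inv D (s.setNat w [] x)) (h0 : Inv ∅ s)
    (hstep : ∀ D (e : Fin n × Fin r) s', e ∉ D → (loopPair v w c).Agree s s' → s'.nat v [] = (e.1 : ℕ) →
      s'.nat w [] = (e.2 : ℕ) → Inv D s' → Inv (insert e D) (c.run s')) :
    Inv Finset.univ ((loopPair v w c).run s) := by
  have hpair := hwf
  simp only [loopPair, wellFormed, natWrites, Bool.and_eq_true, decide_eq_true_eq,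
    Bool.not_eq_true', List.contains_eq_mem, decide_eq_false_iff_not, List.mem_cons,
    not_or] at hwf
  obtain ⟨⟨⟨hv2, -⟩, hvw', hvc⟩, ⟨⟨hw2, -⟩, hwc⟩, hc⟩ := hwf
  -- The outer loop has completed the rows in `D`; the inner one adds the part `{i} ×ˢ D'` of the
  -- current row.
  have h := run_loop (c := loop w 1 c) hn (fun D s => Inv (D ×ˢ Finset.univ) s)
    (fun D s x h => hv _ s x h) (by simpa using h0) (v := v) ?_
  · rwa [Finset.univ_product_univ] at h
  · intro D i s' hi hagree hvi hInv
    have h1 : s'.nat 1 [] = r := by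
      rw [hagree.1 1, hr]
      exact fun hmem => absurd (two_le_of_mem_natWrites hpair hmem) (by norm_num)
    have h2 := run_loop h1 (fun D' s => Inv (D ×ˢ Finset.univ ∪ {i} ×ˢ D') s)
      (fun D s x h => hw _ s x h) (by simpa using hInv) (v := w) (c := c) ?_
    · convert h2 using 1
      rw [Finset.insert_eq, Finset.union_product, Finset.union_comm]
    · intro D' j s'' hj hagree' hwj hInv'
      have h3 := hstep _ (i, j) s'' (by simp [hi, hj]) (hagree.trans ⟨fun a ha => hagree'.1 a (by
        simp only [natWrites, List.mem_cons, not_or] at ha ⊢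
        exact ha.2), fun a ha => hagree'.2 a ha⟩) (by
          rw [hagree'.1 v, hvi]
          simp only [natWrites, List.mem_cons, not_or]
          exact ⟨hvw', hvc⟩) hwj hInv'
      convert h3 using 1
      ext e
      simp only [Finset.mem_union, Finset.mem_product, Finset.mem_insert, Finset.mem_univ,
        Finset.mem_singleton, Prod.ext_iff]
      tauto

end Cmd

end RealRAM

/-! ### Choice probabilities by Gaussian elimination -/

namespace RealRAM

namespace Cmd

variable {n r : ℕ}

theorem pair_ext {e f : Fin n × Fin r} (h1 : (e.1 : ℕ) = f.1) (h2 : (e.2 : ℕ) = f.2) : e = f :=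
  Prod.ext (Fin.ext h1) (Fin.ext h2)

/-- Assigns `a[ix, i, p] := e` for all pairs `(i, p)`. -/
def fill (a : ℕ) (ix : List ℕ) (e : RealExpr) : Cmd :=
  loopPair 16 17 (setReal a (ix ++ [16, 17]) e)

/-- Each cell is written once, so its old value is still there when `e` is evaluated; the last
premise of `he` thereby permits updates in place. -/
theorem run_fill {s : Store} (hn : s.nat 0 [] = n) (hr : s.nat 1 [] = r) (a : ℕ) (ix : List ℕ)
    (hix : ∀ x ∈ ix, x ≠ 16 ∧ x ≠ 17) (e : RealExpr) (new : Fin n × Fin r → ℝ)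
    (he : ∀ (f : Fin n × Fin r) (s' : Store), (∀ b, b ≠ 16 → b ≠ 17 → s'.nat b = s.nat b) →
      (∀ b, b ≠ a → s'.real b = s.real b) → s'.nat 16 [] = (f.1 : ℕ) → s'.nat 17 [] = (f.2 : ℕ) →
      s'.real a (s.addr ix ++ [(f.1 : ℕ), (f.2 : ℕ)]) =
        s.real a (s.addr ix ++ [(f.1 : ℕ), (f.2 : ℕ)]) → e.eval s' = new f) :
    (∀ f : Fin n × Fin r, ((fill a ix e).run s).real a
        (s.addr ix ++ [(f.1 : ℕ), (f.2 : ℕ)]) = new f) ∧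
      ∀ l, (∀ f : Fin n × Fin r, l ≠ s.addr ix ++ [(f.1 : ℕ), (f.2 : ℕ)]) →
        ((fill a ix e).run s).real a l = s.real a l := by
  have h := run_loopPair (c := setReal a (ix ++ [16, 17]) e) (v := 16) (w := 17) rfl hn hr
    (fun (D : Finset (Fin n × Fin r)) s' =>
      (∀ f : Fin n × Fin r, s'.real a (s.addr ix ++ [(f.1 : ℕ), (f.2 : ℕ)]) =
        if f ∈ D then new f else s.real a (s.addr ix ++ [(f.1 : ℕ), (f.2 : ℕ)])) ∧
      ∀ l, (∀ f : Fin n × Fin r, l ≠ s.addr ix ++ [(f.1 : ℕ), (f.2 : ℕ)]) →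
        s'.real a l = s.real a l)
    (fun _ _ _ h => h) (fun _ _ _ h => h) ⟨by simp, fun _ _ => rfl⟩ ?_
  · exact ⟨fun f => (h.1 f).trans (by simp), h.2⟩
  · intro D f s' hf hagree h16 h17 hInv
    have hnat : ∀ b, b ≠ 16 → b ≠ 17 → s'.nat b = s.nat b := fun b h1 h2 =>
      hagree.1 b (by simp [loopPair, natWrites, h1, h2])
    have hreal : ∀ b, b ≠ a → s'.real b = s.real b := fun b h1 =>
      hagree.2 b (by simp [loopPair, realWrites, h1])
    have haddr : s'.addr (ix ++ [16, 17]) = s.addr ix ++ [(f.1 : ℕ), (f.2 : ℕ)] := by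
      simp only [Store.addr, List.map_append, List.map_cons, List.map_nil, h16, h17]
      congr 1
      exact List.map_congr_left fun x hx => by rw [hnat x (hix x hx).1 (hix x hx).2]
    have hval := he f s' hnat hreal h16 h17 (by rw [hInv.1 f, if_neg hf])
    rw [run, haddr, hval]
    refine ⟨fun d => ?_, fun l hl => ?_⟩
    · by_cases hdf : d = f
      · simp [hdf]
      · have hne : ¬ ((d.1 : ℕ) = f.1 ∧ (d.2 : ℕ) = f.2) := fun h => hdf (pair_ext h.1 h.2)
        simp only [Store.setReal_real, if_true, List.append_cancel_left_eq, List.cons.injEq,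
          and_true, if_neg hne, Finset.mem_insert, hdf, false_or]
        exact hInv.1 d
    · rw [Store.setReal_real, if_pos rfl, if_neg (hl f)]
      exact hInv.2 l hl

/-- Eliminates the state `x` stored in the scalars `12, 13` from the chain in the arrays
`10` (transitions) and `11` (initial probabilities). -/
def pivot : Cmd :=
  seq (fill 12 [] (.div (.read 10 [12, 13, 16, 17]) (.sub (.lit 1) (.read 10 [12, 13, 12, 13]))))
    (seq (loopPair 14 15 (seq (setReal 13 [] (.read 10 [14, 15, 12, 13]))
        (fill 10 [14, 15] (.add (.read 10 [14, 15, 16, 17])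
          (.mul (.read 13 []) (.read 12 [16, 17]))))))
      (seq (setReal 13 [] (.read 11 [12, 13]))
        (fill 11 [] (.add (.read 11 [16, 17]) (.mul (.read 13 []) (.read 12 [16, 17]))))))

/-- The entries of the array `10`. -/
def mat (s : Store) (e f : Fin n × Fin r) : ℝ :=
  s.real 10 [(e.1 : ℕ), (e.2 : ℕ), (f.1 : ℕ), (f.2 : ℕ)]

/-- The entries of the array `a`. -/
def vec (s : Store) (a : ℕ) (e : Fin n × Fin r) : ℝ :=
  s.real a [(e.1 : ℕ), (e.2 : ℕ)]

/-- The rank-one update can be done in place, even in row `x`, because the normalized pivot row is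
saved in array `12` and the factor of the current row in the scalar `13` before they are
overwritten. -/
theorem run_pivot {s : Store} (hn : s.nat 0 [] = n) (hr : s.nat 1 [] = r) (x : Fin n × Fin r)
    (h12 : s.nat 12 [] = (x.1 : ℕ)) (h13 : s.nat 13 [] = (x.2 : ℕ)) :
    (∀ e f : Fin n × Fin r, mat (pivot.run s) e f =
      mat s e f + mat s e x * (mat s x f / (1 - mat s x x))) ∧
    ∀ f : Fin n × Fin r, vec (pivot.run s) 11 f =
      vec s 11 f + vec s 11 x * (mat s x f / (1 - mat s x x)) := by
  set q : Fin n × Fin r → ℝ := fun f => mat s x f / (1 - mat s x x) with hq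
  set c1 := fill 12 [] (.div (.read 10 [12, 13, 16, 17])
    (.sub (.lit 1) (.read 10 [12, 13, 12, 13]))) with hc1
  set s1 := c1.run s with hs1
  have ha1 := c1.agree_run s
  have h1 : ∀ f, vec s1 12 f = q f := by
    refine (run_fill hn hr 12 [] (by simp) _ q ?_).1
    intro f s' hnat hreal h16 h17 _
    simp [RealExpr.eval, Store.addr, hnat, hreal, h16, h17, h12, h13, hq, mat]
  set c2 := loopPair 14 15 (seq (setReal 13 [] (.read 10 [14, 15, 12, 13]))
        (fill 10 [14, 15] (.add (.read 10 [14, 15, 16, 17])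
          (.mul (.read 13 []) (.read 12 [16, 17]))))) with hc2
  set s2 := c2.run s1 with hs2
  have ha2 := c2.agree_run s1
  have h2 : ∀ e f, mat s2 e f = mat s e f + mat s e x * q f := by
    have h := run_loopPair (s := s1) (c := seq (setReal 13 [] (.read 10 [14, 15, 12, 13]))
        (fill 10 [14, 15] (.add (.read 10 [14, 15, 16, 17])
          (.mul (.read 13 []) (.read 12 [16, 17]))))) (v := 14) (w := 15) rfl
      (by rw [hs1, ha1.1 0 (by decide), hn]) (by rw [hs1, ha1.1 1 (by decide), hr])
      (fun (D : Finset (Fin n × Fin r)) s' => ∀ e f : Fin n × Fin r, mat s' e f =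
        if e ∈ D then mat s e f + mat s e x * q f else mat s e f)
      (fun _ _ _ h => h) (fun _ _ _ h => h) ?_ ?_
    · exact fun e f => (h e f).trans (by simp)
    · intro e f
      simp [mat, hs1, ha1.2 10 (by decide)]
    · intro D e s' he hagree h14 h15 hInv
      have hnat : ∀ b, b ≠ 14 → b ≠ 15 → b ≠ 16 → b ≠ 17 → s'.nat b = s.nat b := by
        intro b _ _ _ _
        rw [hagree.1 b (by simp [loopPair, fill, natWrites, *]), hs1,
          ha1.1 b (by simp [loopPair, fill, natWrites, *])]
      have h12' : ∀ f : Fin n × Fin r, s'.real 12 [(f.1 : ℕ), (f.2 : ℕ)] = q f := fun f => by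
        rw [hagree.2 12 (by decide)]; exact h1 f
      have hrow : ∀ f, mat s' e f = mat s e f := fun f => by rw [hInv, if_neg he]
      rw [run]
      set s3 := (setReal 13 [] (.read 10 [14, 15, 12, 13])).run s' with hs3
      have h3n : s3.nat = s'.nat := rfl
      have h3r : ∀ b, b ≠ 13 → s3.real b = s'.real b := fun b hb =>
        Store.setReal_real_of_ne _ _ _ hb
      have h313 : s3.real 13 [] = mat s e x := by
        rw [← hrow]
        simp [hs3, run, RealExpr.eval, Store.addr, mat, hnat, h14, h15, h12, h13]
      have hf := run_fill (n := n) (r := r) (s := s3)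
        (by rw [h3n, hnat 0 (by simp) (by simp) (by simp) (by simp), hn])
        (by rw [h3n, hnat 1 (by simp) (by simp) (by simp) (by simp), hr]) 10 [14, 15] (by simp)
        (.add (.read 10 [14, 15, 16, 17]) (.mul (.read 13 []) (.read 12 [16, 17])))
        (fun f => mat s e f + mat s e x * q f) ?_
      · simp only [Store.addr, List.map_cons, List.map_nil, List.cons_append, List.nil_append,
          h3n, h14, h15] at hf
        intro d f
        by_cases hde : d = e
        · subst hde
          rw [if_pos (Finset.mem_insert_self _ _)]
          exact hf.1 f
        · have hne : ¬ ((d.1 : ℕ) = e.1 ∧ (d.2 : ℕ) = e.2) := fun h => hde (pair_ext h.1 h.2)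
          have h4 := hf.2 [(d.1 : ℕ), (d.2 : ℕ), (f.1 : ℕ), (f.2 : ℕ)] (by
            intro g
            simp only [ne_eq, List.cons.injEq]
            tauto)
          rw [mat, h4, h3r 10 (by simp)]
          simp only [Finset.mem_insert, hde, false_or]
          exact hInv d f
      · intro f s'' hn'' hr'' h16 h17 hcell
        simp only [Store.addr, List.map_cons, List.map_nil, List.cons_append, List.nil_append,
          h3n, h14, h15] at hcell
        have h14'' : s''.nat 14 [] = (e.1 : ℕ) := by rw [hn'' 14 (by simp) (by simp), h3n, h14]
        have h15'' : s''.nat 15 [] = (e.2 : ℕ) := by rw [hn'' 15 (by simp) (by simp), h3n, h15]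
        have h13'' : s''.real 13 [] = mat s e x := by rw [hr'' 13 (by simp), h313]
        simp only [RealExpr.eval, Store.addr, List.map_cons, List.map_nil, h14'', h15'', h16, h17,
          h13'', hcell, hr'' 12 (by simp), h3r 12 (by simp), h3r 10 (by simp), h12']
        exact congrArg (· + _) (hrow f)
  set c3 : Cmd := setReal 13 [] (.read 11 [12, 13]) with hc3
  set c4 := fill 11 [] (.add (.read 11 [16, 17]) (.mul (.read 13 []) (.read 12 [16, 17]))) with hc4
  set s3 := c3.run s2 with hs3
  have h11 : ∀ l, s2.real 11 l = s.real 11 l := fun l => by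
    rw [hs2, ha2.2 11 (by decide), hs1, ha1.2 11 (by decide)]
  have hnat2 : ∀ b, b ≠ 14 → b ≠ 15 → b ≠ 16 → b ≠ 17 → s2.nat b = s.nat b := by
    intro b _ _ _ _
    rw [hs2, ha2.1 b (by simp [loopPair, fill, natWrites, *]), hs1,
      ha1.1 b (by simp [loopPair, fill, natWrites, *])]
  have h313 : s3.real 13 [] = vec s 11 x := by
    simp [hs3, hc3, run, RealExpr.eval, Store.addr, vec, hnat2, h12, h13, h11]
  have h3n : s3.nat = s2.nat := rfl
  have h3r : ∀ b, b ≠ 13 → s3.real b = s2.real b := fun b hb =>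
    Store.setReal_real_of_ne _ _ _ hb
  have hrun : pivot.run s = c4.run s3 := rfl
  have ha4 := c4.agree_run s3
  refine ⟨fun e f => ?_, ?_⟩
  · rw [← h2, hrun, mat, ha4.2 10 (by decide), h3r 10 (by simp)]
    rfl
  · rw [hrun]
    refine (run_fill (n := n) (r := r) (s := s3) ?_ ?_ 11 [] (by simp) _ _ ?_).1
    · rw [h3n, hnat2 0 (by simp) (by simp) (by simp) (by simp), hn]
    · rw [h3n, hnat2 1 (by simp) (by simp) (by simp) (by simp), hr]
    · intro f s'' hn'' hr'' h16 h17 hcell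
      have hq12 : s2.real 12 [(f.1 : ℕ), (f.2 : ℕ)] = q f := by
        rw [hs2, ha2.2 12 (by decide)]; exact h1 f
      simp only [Store.addr, List.map_nil, List.nil_append] at hcell
      simp only [RealExpr.eval, Store.addr, List.map_cons, List.map_nil, h16, h17, hcell,
        hr'' 13 (by simp), hr'' 12 (by simp), h313, h3r 12 (by simp), h3r 11 (by simp), h11, hq12]
      rfl

/-- Computes the choice probabilities for the assortment stored in the array `4`. -/
def evaluate : Cmd :=
  seq (fill 11 [] (.read 1 [16, 17]))
    (seq (loopPair 14 15 (fill 10 [14, 15] (.read 2 [14, 15, 16, 17])))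
      (loopPair 12 13 (ite (.natLe (.read 4 [12, 13]) (.lit 0)) pivot skip)))

open PricingInstance in
-- With every state offered, choice probabilities are just initial or one-step probabilities;
-- eliminating the states outside `A` leads to those for `A`. Rows of eliminated states stay valid,
-- since `startAfter e` is itself a chain with the same transitions; their columns lose their
-- meaning.
theorem run_evaluate {I : PricingInstance n r} {s : Store} (hn : s.nat 0 [] = n)
    (hr : s.nat 1 [] = r) (hinit : s.real 1 = I.inputReal 1) (htrans : s.real 2 = I.inputReal 2)
    {A : Finset (Fin n × Fin r)}
    (hA : ∀ e : Fin n × Fin r, s.nat 4 [(e.1 : ℕ), (e.2 : ℕ)] = if e ∈ A then 1 else 0) :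
    (∀ f ∈ A, vec (evaluate.run s) 11 f = I.model.choiceProb f A) ∧
    ∀ e, ∀ f ∈ A, mat (evaluate.run s) e f = (I.model.startAfter e).choiceProb f A := by
  set c1 := fill 11 [] (.read 1 [16, 17]) with hc1
  set s1 := c1.run s with hs1
  have ha1 := c1.agree_run s
  have h1 : ∀ f : Fin n × Fin r, vec s1 11 f = I.model.init f := by
    refine (run_fill hn hr 11 [] (by simp) _ _ ?_).1
    intro f s' hnat hreal h16 h17 _
    simp [RealExpr.eval, Store.addr, hreal, h16, h17, hinit, inputReal]
  set c2 := loopPair 14 15 (fill 10 [14, 15] (.read 2 [14, 15, 16, 17])) with hc2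
  set s2 := c2.run s1 with hs2
  have ha2 := c2.agree_run s1
  have h2 : ∀ e f : Fin n × Fin r, mat s2 e f = I.model.trans e f := by
    have h := run_loopPair (s := s1) (c := fill 10 [14, 15] (.read 2 [14, 15, 16, 17]))
      (v := 14) (w := 15) rfl
      (by rw [hs1, ha1.1 0 (by decide), hn]) (by rw [hs1, ha1.1 1 (by decide), hr])
      (fun (D : Finset (Fin n × Fin r)) s' => ∀ e ∈ D, ∀ f : Fin n × Fin r, mat s' e f =
        I.model.trans e f)
      (fun _ _ _ h => h) (fun _ _ _ h => h) (by simp) ?_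
    · exact fun e f => h e (Finset.mem_univ _) f
    · intro D e s' he hagree h14 h15 hInv
      have hf := run_fill (n := n) (r := r) (s := s')
        (by rw [hagree.1 0 (by decide), hs1, ha1.1 0 (by decide), hn])
        (by rw [hagree.1 1 (by decide), hs1, ha1.1 1 (by decide), hr]) 10 [14, 15] (by simp)
        (.read 2 [14, 15, 16, 17]) (fun f => I.model.trans e f) ?_
      · simp only [Store.addr, List.map_cons, List.map_nil, List.cons_append, List.nil_append,
          h14, h15] at hf
        intro d hd f
        by_cases hde : d = e
        · subst hde
          exact hf.1 f
        · have hne : ¬ ((d.1 : ℕ) = e.1 ∧ (d.2 : ℕ) = e.2) := fun h => hde (pair_ext h.1 h.2)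
          have h4 := hf.2 [(d.1 : ℕ), (d.2 : ℕ), (f.1 : ℕ), (f.2 : ℕ)] (by
            intro g
            simp only [ne_eq, List.cons.injEq]
            tauto)
          rw [mat, h4]
          exact hInv d ((Finset.mem_insert.1 hd).resolve_left hde) f
      · intro f s'' hn'' hr'' h16 h17 _
        have hr2 : s''.real 2 = I.inputReal 2 := by
          rw [hr'' 2 (by simp), hagree.2 2 (by decide), hs1, ha1.2 2 (by decide), htrans]
        simp [RealExpr.eval, Store.addr, hr2, h16, h17, hn'', h14, h15, inputReal]
  have hnat2 : ∀ b, b ≠ 14 → b ≠ 15 → b ≠ 16 → b ≠ 17 → s2.nat b = s.nat b := by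
    intro b _ _ _ _
    rw [hs2, ha2.1 b (by simp [loopPair, fill, natWrites, *]), hs1,
      ha1.1 b (by simp [loopPair, fill, natWrites, *])]
  have h := run_loopPair (s := s2) (c := ite (.natLe (.read 4 [12, 13]) (.lit 0)) pivot skip)
      (v := 12) (w := 13) rfl
      (by rw [hnat2 0 (by simp) (by simp) (by simp) (by simp), hn])
      (by rw [hnat2 1 (by simp) (by simp) (by simp) (by simp), hr])
      (fun (D : Finset (Fin n × Fin r)) s' => ∀ f ∈ (D \ A)ᶜ,
        vec s' 11 f = I.model.choiceProb f (D \ A)ᶜ ∧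
        ∀ e, mat s' e f = (I.model.startAfter e).choiceProb f (D \ A)ᶜ)
      (fun _ _ _ h => h) (fun _ _ _ h => h) ?_ ?_
  · have hU : (Finset.univ \ A)ᶜ = A := by
      ext; simp
    rw [hU] at h
    exact ⟨fun f hf => (h f hf).1, fun e f hf => (h f hf).2 e⟩
  · intro f _
    rw [Finset.empty_sdiff, Finset.compl_empty]
    refine ⟨?_, fun e => ?_⟩
    · rw [MarkovChoiceModel.choiceProb_univ, ← h1, hs2, vec, ha2.2 11 (by decide)]
      rfl
    · rw [MarkovChoiceModel.choiceProb_univ, h2]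
      rfl
  · intro D x s' hx hagree h12 h13 hInv
    have hnat : ∀ b, b = 0 ∨ b = 1 ∨ b = 4 → s'.nat b = s.nat b := by
      intro b hb
      rw [← hnat2 b (by omega) (by omega) (by omega) (by omega)]
      rcases hb with rfl | rfl | rfl <;> exact hagree.1 _ (by decide)
    have htest : (Test.natLe (.read 4 [12, 13]) (.lit 0)).Holds s' ↔ x ∉ A := by
      simp [Test.Holds, NatExpr.eval, Store.addr, h12, h13, hnat, hA]
    rw [run]
    simp only [htest]
    by_cases hxA : x ∈ A
    · rw [if_neg (not_not.2 hxA), Finset.insert_sdiff_of_mem _ hxA]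
      exact hInv
    · rw [if_pos hxA]
      have hp := run_pivot (n := n) (r := r) (by rw [hnat 0 (by simp), hn])
        (by rw [hnat 1 (by simp), hr]) x h12 h13
      set B := (insert x D \ A)ᶜ with hB
      have hxB : x ∉ B := by simp [hB, hxA]
      have hins : (D \ A)ᶜ = insert x B := by
        ext f
        simp only [hB, Finset.mem_compl, Finset.mem_sdiff, Finset.mem_insert]
        by_cases hfx : f = x
        · simp [hfx, hx]
        · simp [hfx]
      rw [hins] at hInv
      intro f hf
      have hf' := Finset.mem_insert_of_mem (b := x) hf
      have hx' := Finset.mem_insert_self x B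
      refine ⟨?_, fun e => ?_⟩
      · rw [hp.2, (hInv f hf').1, (hInv x hx').1, (hInv f hf').2, (hInv x hx').2,
          ← MarkovChoiceModel.choiceProb_eliminate _ hxB hf]
      · rw [hp.1, (hInv f hf').2, (hInv x hx').2, (hInv f hf').2, (hInv x hx').2]
        exact (MarkovChoiceModel.choiceProb_eliminate (I.model.startAfter e) hxB hf).symm

end Cmd

end RealRAM

/-! ### The local search as a program -/

open PricingInstance

namespace RealRAM

/-- The store `s` holds the input `I` and the state of the local search. -/
structure Represents {n r : ℕ} (I : PricingInstance n r) (s : Store) (σ : PricedAssortment n r)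
    (wt : Fin n → ℝ) (A U : Finset (Fin n × Fin r)) : Prop where
  products : s.nat 0 [] = n
  ladder : s.nat 1 [] = r
  limit : s.nat 2 [] = I.k
  outputs : s.Outputs σ
  accepted : ∀ e : Fin n × Fin r, s.nat 4 [(e.1 : ℕ), (e.2 : ℕ)] = if e ∈ A then 1 else 0
  examined : ∀ e : Fin n × Fin r, s.nat 5 [(e.1 : ℕ), (e.2 : ℕ)] = if e ∈ U then 0 else 1
  price : s.real 0 = I.inputReal 0
  init : s.real 1 = I.inputReal 1
  trans : s.real 2 = I.inputReal 2
  weight : ∀ i : Fin n, s.real 16 [(i : ℕ)] = wt i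

theorem Represents.congr {n r : ℕ} {I : PricingInstance n r} {s s' : Store}
    {σ : PricedAssortment n r} {wt : Fin n → ℝ} {A U : Finset (Fin n × Fin r)}
    (h : Represents I s σ wt A U) (hnat : ∀ a ≤ 5, s'.nat a = s.nat a)
    (h0 : s'.real 0 = s.real 0) (h1 : s'.real 1 = s.real 1) (h2 : s'.real 2 = s.real 2)
    (h16 : s'.real 16 = s.real 16) : Represents I s' σ wt A U where
  products := by rw [hnat 0 (by omega), h.products]
  ladder := by rw [hnat 1 (by omega), h.ladder]
  limit := by rw [hnat 2 (by omega), h.limit]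
  outputs i := by rw [hnat 3 (by omega), h.outputs i]
  accepted e := by rw [hnat 4 (by omega), h.accepted e]
  examined e := by rw [hnat 5 (by omega), h.examined e]
  price := by rw [h0, h.price]
  init := by rw [h1, h.init]
  trans := by rw [h2, h.trans]
  weight i := by rw [h16, h.weight i]

namespace Cmd

variable {n r : ℕ}

theorem Agree.represents {I : PricingInstance n r} {s s' : Store} {c : Cmd}
    {σ : PricedAssortment n r} {wt : Fin n → ℝ} {A U : Finset (Fin n × Fin r)}
    (hc : c.Agree s s') (h : Represents I s σ wt A U) (hnat : ∀ a ∈ c.natWrites, 5 < a)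
    (hreal : 0 ∉ c.realWrites ∧ 1 ∉ c.realWrites ∧ 2 ∉ c.realWrites ∧ 16 ∉ c.realWrites) :
    Represents I s' σ wt A U :=
  h.congr (fun a ha => hc.1 a fun hmem => absurd (hnat a hmem) (by omega))
    (hc.2 0 hreal.1) (hc.2 1 hreal.2.1) (hc.2 2 hreal.2.2.1) (hc.2 16 hreal.2.2.2)

/-- Stores the adjusted price of the pair in the scalars `14, 15`. -/
def adjust : Cmd :=
  seq (setReal 15 [] (.read 0 [15]))
    (loopPair 16 17 (ite (.natLe (.lit 1) (.read 4 [16, 17]))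
      (setReal 15 [] (.sub (.read 15 []) (.mul (.read 10 [14, 15, 16, 17]) (.read 0 [17])))) skip))

/-- The matrix describes walks after a first transition from `e`; as `e ∉ A`, these have the same
choice probabilities as walks started at `e`. -/
theorem run_adjust {I : PricingInstance n r} {s : Store} {σ : PricedAssortment n r}
    {wt : Fin n → ℝ} {A U : Finset (Fin n × Fin r)} (hs : Represents I s σ wt A U)
    (hmat : ∀ e, ∀ f ∈ A, mat s e f = (I.model.startAfter e).choiceProb f A)
    {e : Fin n × Fin r} (he : e ∉ A) (h14 : s.nat 14 [] = (e.1 : ℕ))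
    (h15 : s.nat 15 [] = (e.2 : ℕ)) : (adjust.run s).real 15 [] = I.adjustedPrice A e := by
  have hprice : ∀ p : Fin r, s.real 0 [(p : ℕ)] = I.price p := fun p => by
    simp [hs.price, inputReal]
  rw [adjust, run]
  set s1 := (setReal 15 [] (.read 0 [15])).run s with hs1
  have h1r : ∀ b, b ≠ 15 → s1.real b = s.real b := fun b hb => Store.setReal_real_of_ne _ _ _ hb
  have h := run_loopPair (s := s1) (c := ite (.natLe (.lit 1) (.read 4 [16, 17]))
      (setReal 15 [] (.sub (.read 15 []) (.mul (.read 10 [14, 15, 16, 17]) (.read 0 [17])))) skip)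
    (v := 16) (w := 17) rfl hs.products hs.ladder
    (fun (D : Finset (Fin n × Fin r)) s' => s'.real 15 [] =
      I.price e.2 - ∑ f ∈ D, if f ∈ A then mat s e f * I.price f.2 else 0)
    (fun _ _ _ h => h) (fun _ _ _ h => h) ?_ ?_
  · rw [h, adjustedPrice, revenueAt, MarkovChoiceModel.revenue]
    congr 1
    rw [← Finset.sum_filter, Finset.filter_mem_eq_inter, Finset.univ_inter]
    exact Finset.sum_congr rfl fun f hf => by
      rw [hmat e f hf, MarkovChoiceModel.choiceProb_startAt _ he hf, mul_comm]
  · simp [hs1, run, RealExpr.eval, Store.addr, h15, hprice]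
  · intro D f s' hf hagree h16 h17 hInv
    have h4 : s'.nat 4 [(f.1 : ℕ), (f.2 : ℕ)] = if f ∈ A then 1 else 0 := by
      rw [hagree.1 4 (by decide)]; exact hs.accepted f
    have h14' : s'.nat 14 [] = (e.1 : ℕ) := by rw [hagree.1 14 (by decide)]; exact h14
    have h15' : s'.nat 15 [] = (e.2 : ℕ) := by rw [hagree.1 15 (by decide)]; exact h15
    have hp : s'.real 0 [(f.2 : ℕ)] = I.price f.2 := by
      rw [hagree.2 0 (by decide), h1r 0 (by simp), hprice]
    have hm : s'.real 10 [(e.1 : ℕ), (e.2 : ℕ), (f.1 : ℕ), (f.2 : ℕ)] = mat s e f := by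
      rw [hagree.2 10 (by decide), h1r 10 (by simp)]; rfl
    rw [Finset.sum_insert hf, run]
    by_cases hfA : f ∈ A
    · rw [if_pos (by simp [Test.Holds, NatExpr.eval, Store.addr, h16, h17, h4, hfA])]
      simp only [run, RealExpr.eval, Store.addr, List.map_cons, List.map_nil, Store.setReal_real,
        if_true, h14', h15', h16, h17, hp, hm, hInv, if_pos hfA]
      ring
    · rw [if_neg (by simp [Test.Holds, NatExpr.eval, Store.addr, h16, h17, h4, hfA]), run, hInv,
        if_neg hfA, zero_add]

/-- Finds the unexamined pair with the largest adjusted price. -/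
def select : Cmd :=
  seq (setNat 22 [] (.lit 0))
    (loopPair 14 15 (ite (.natLe (.read 5 [14, 15]) (.lit 0))
      (seq adjust
        (ite (.not (.and (.natLe (.lit 1) (.read 22 [])) (.realLe (.read 15 []) (.read 14 []))))
          (seq (setNat 22 [] (.lit 1)) (seq (setReal 14 [] (.read 15 []))
            (seq (setNat 20 [] (.read 14 [])) (setNat 21 [] (.read 15 [])))))
          skip))
      skip))

/-- Adjusted prices may be negative, so the running maximum has no neutral initial value; the flag
in the scalar `22` tells whether a candidate has been seen. -/
theorem run_select {I : PricingInstance n r} {s : Store} {σ : PricedAssortment n r}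
    {wt : Fin n → ℝ} {A U : Finset (Fin n × Fin r)} (hs : Represents I s σ wt A U)
    (hAU : Disjoint A U)
    (hmat : ∀ e, ∀ f ∈ A, mat s e f = (I.model.startAfter e).choiceProb f A) :
    ((select.run s).nat 22 [] = 0 ∧ U = ∅) ∨ ((select.run s).nat 22 [] = 1 ∧
      ∃ e ∈ U, (select.run s).nat 20 [] = (e.1 : ℕ) ∧ (select.run s).nat 21 [] = (e.2 : ℕ) ∧
        (select.run s).real 14 [] = I.adjustedPrice A e ∧
        ∀ d ∈ U, I.adjustedPrice A d ≤ I.adjustedPrice A e) := by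
  rw [select, run]
  have hs1 : Represents I ((setNat 22 [] (.lit 0)).run s) σ wt A U :=
    (agree_run _ _).represents hs (by decide) (by decide)
  set s1 := (setNat 22 [] (.lit 0)).run s with hs1def
  have h := run_loopPair (s := s1) (c := ite (.natLe (.read 5 [14, 15]) (.lit 0))
      (seq adjust
        (ite (.not (.and (.natLe (.lit 1) (.read 22 [])) (.realLe (.read 15 []) (.read 14 []))))
          (seq (setNat 22 [] (.lit 1)) (seq (setReal 14 [] (.read 15 []))
            (seq (setNat 20 [] (.read 14 [])) (setNat 21 [] (.read 15 [])))))
          skip))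
      skip) (v := 14) (w := 15) rfl hs1.products hs1.ladder
    (fun (D : Finset (Fin n × Fin r)) s' => (s'.nat 22 [] = 0 ∧ D ∩ U = ∅) ∨
      (s'.nat 22 [] = 1 ∧ ∃ e ∈ U, s'.nat 20 [] = (e.1 : ℕ) ∧ s'.nat 21 [] = (e.2 : ℕ) ∧
        s'.real 14 [] = I.adjustedPrice A e ∧
        ∀ d ∈ D ∩ U, I.adjustedPrice A d ≤ I.adjustedPrice A e))
    (fun _ _ _ h => h) (fun _ _ _ h => h) ?_ ?_
  · rwa [Finset.univ_inter] at h
  · left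
    simp [hs1def, run, NatExpr.eval, Store.addr]
  · intro D e s' he hagree h14 h15 hInv
    have hs' : Represents I s' σ wt A U := hagree.represents hs1 (by decide) (by decide)
    have hmat' : ∀ e, ∀ f ∈ A, mat s' e f = (I.model.startAfter e).choiceProb f A := by
      intro e f hf
      rw [mat, hagree.2 10 (by decide)]
      exact hmat e f hf
    rw [run]
    by_cases heU : e ∈ U
    · rw [if_pos (by simp [Test.Holds, NatExpr.eval, Store.addr, h14, h15, hs'.examined, heU]), run]
      have hadj := run_adjust hs' hmat' (Finset.disjoint_right.1 hAU heU) h14 h15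
      have ha := adjust.agree_run s'
      set s2 := adjust.run s' with hs2
      have hnat : ∀ b, b = 14 ∨ b = 15 ∨ b = 20 ∨ b = 21 ∨ b = 22 → s2.nat b = s'.nat b := by
        rintro b (rfl | rfl | rfl | rfl | rfl) <;> exact ha.1 _ (by decide)
      have h14r : s2.real 14 = s'.real 14 := ha.2 14 (by decide)
      have hT : (Test.not (.and (.natLe (.lit 1) (.read 22 []))
          (.realLe (.read 15 []) (.read 14 [])))).Holds s2 ↔
          ¬ (1 ≤ s'.nat 22 [] ∧ I.adjustedPrice A e ≤ s'.real 14 []) := by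
        simp only [Test.Holds, NatExpr.eval, RealExpr.eval, Store.addr, List.map_nil, hadj, h14r,
          hnat 22 (by simp)]
      rw [run]
      simp only [hT]
      have hins : insert e D ∩ U = insert e (D ∩ U) := Finset.insert_inter_of_mem heU
      rw [hins]
      right
      by_cases hbetter : 1 ≤ s'.nat 22 [] ∧ I.adjustedPrice A e ≤ s'.real 14 []
      · rw [if_neg (not_not.2 hbetter)]
        rcases hInv with ⟨h22, -⟩ | ⟨h22, b, hbU, h20, h21, hb, hmax⟩
        · rw [h22] at hbetter; omega
        · rw [run, hnat 22 (by simp), hnat 20 (by simp), hnat 21 (by simp), h14r]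
          refine ⟨h22, b, hbU, h20, h21, hb, fun d hd => ?_⟩
          rcases Finset.mem_insert.1 hd with rfl | hd
          · exact hb ▸ hbetter.2
          · exact hmax d hd
      · rw [if_pos hbetter]
        refine ⟨by simp [run, NatExpr.eval, Store.addr], e, heU, ?_, ?_, ?_, ?_⟩
        · simp [run, NatExpr.eval, Store.addr, hnat, h14]
        · simp [run, NatExpr.eval, Store.addr, hnat, h15]
        · simp [run, RealExpr.eval, Store.addr, hadj]
        · intro d hd
          rcases Finset.mem_insert.1 hd with rfl | hd
          · exact le_rfl
          · rcases hInv with ⟨-, hD⟩ | ⟨h22, b, -, -, -, hb, hmax⟩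
            · rw [hD] at hd; simp at hd
            · rw [h22, hb] at hbetter
              have : ¬ I.adjustedPrice A e ≤ I.adjustedPrice A b := fun h => hbetter ⟨le_rfl, h⟩
              exact (hmax d hd).trans (not_le.1 this).le
    · rw [if_neg (by simp [Test.Holds, NatExpr.eval, Store.addr, h14, h15, hs'.examined, heU]), run,
        Finset.insert_inter_of_notMem heU]
      exact hInv

/-- Counts the offered products. -/
def count : Cmd :=
  seq (setNat 24 [] (.lit 0))
    (loop 25 0 (ite (.natLe (.lit 1) (.read 3 [25]))
      (setNat 24 [] (.add (.read 24 []) (.lit 1))) skip))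

theorem one_le_output {s : Store} {σ : PricedAssortment n r} (h : s.Outputs σ) (i : Fin n) :
    1 ≤ s.nat 3 [(i : ℕ)] ↔ σ i ≠ none := by
  rw [h i]
  cases σ i <;> simp

theorem run_count {s : Store} {σ : PricedAssortment n r} (hn : s.nat 0 [] = n)
    (h : s.Outputs σ) : (count.run s).nat 24 [] = (support σ).card := by
  rw [count, run]
  set s1 := (setNat 24 [] (.lit 0)).run s with hs1
  have h' := run_loop (s := s1) (v := 25) (N := 0) (c := ite (.natLe (.lit 1) (.read 3 [25]))
      (setNat 24 [] (.add (.read 24 []) (.lit 1))) skip) hn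
    (fun D s' => s'.nat 24 [] = (D.filter fun i => σ i ≠ none).card) (fun _ _ _ h => h)
    (by simp [hs1, run, NatExpr.eval, Store.addr]) ?_
  · exact h'
  · intro D i s' hi hagree h25 hInv
    have hout := one_le_output h i
    rw [show s.nat 3 = s'.nat 3 from (hagree.1 3 (by decide)).symm] at hout
    have hT : (Test.natLe (.lit 1) (.read 3 [25])).Holds s' ↔ σ i ≠ none := by
      rw [← hout]
      simp [Test.Holds, NatExpr.eval, Store.addr, h25]
    rw [run]
    simp only [hT]
    by_cases hσ : σ i = none
    · rw [if_neg (not_not.2 hσ), Finset.filter_insert, if_neg (not_not.2 hσ)]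
      exact hInv
    · rw [if_pos hσ, Finset.filter_insert, if_pos hσ, Finset.card_insert_of_notMem (by simp [hi]),
        ← hInv]
      simp [run, NatExpr.eval, Store.addr]

/-- Replaces the product in the scalar `23` by an offered product of least weight. -/
def findLightest : Cmd :=
  loop 25 0 (ite (.and (.natLe (.lit 1) (.read 3 [25]))
    (.not (.and (.natLe (.lit 1) (.read 3 [23])) (.realLe (.read 16 [23]) (.read 16 [25])))))
    (setNat 23 [] (.read 25 [])) skip)

theorem run_findLightest {s : Store} {σ : PricedAssortment n r} {wt : Fin n → ℝ}
    (hn : s.nat 0 [] = n) (h : s.Outputs σ) (hwt : ∀ i : Fin n, s.real 16 [(i : ℕ)] = wt i)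
    {i : Fin n} (h23 : s.nat 23 [] = (i : ℕ)) :
    ∃ v : Fin n, (findLightest.run s).nat 23 [] = (v : ℕ) ∧
      ((support σ).Nonempty → σ v ≠ none ∧ ∀ j, σ j ≠ none → wt v ≤ wt j) := by
  have h' := run_loop (s := s) (v := 25) (N := 0)
    (c := ite (.and (.natLe (.lit 1) (.read 3 [25]))
      (.not (.and (.natLe (.lit 1) (.read 3 [23])) (.realLe (.read 16 [23]) (.read 16 [25])))))
      (setNat 23 [] (.read 25 [])) skip) hn
    -- The initial `v` need not be offered. The first offered product then replaces it, because the
    -- test also checks whether `v` is offered.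
    (fun D s' => ∃ v : Fin n, s'.nat 23 [] = (v : ℕ) ∧
      ∀ j ∈ D, σ j ≠ none → σ v ≠ none ∧ wt v ≤ wt j) (fun _ _ _ h => h)
    ⟨i, h23, by simp⟩ ?_
  · obtain ⟨v, hv, hmin⟩ := h'
    exact ⟨v, hv, fun ⟨j, hj⟩ => ⟨(hmin j (Finset.mem_univ _) (mem_support.1 hj)).1,
      fun j hj => (hmin j (Finset.mem_univ _) hj).2⟩⟩
  · rintro D j s' hj hagree h25 ⟨v, hv, hmin⟩
    have hout : s'.Outputs σ := fun i => by rw [hagree.1 3 (by decide)]; exact h i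
    have hwt' : ∀ i : Fin n, s'.real 16 [(i : ℕ)] = wt i := fun i => by
      rw [hagree.2 16 (by decide)]; exact hwt i
    have hT : (Test.and (.natLe (.lit 1) (.read 3 [25]))
        (.not (.and (.natLe (.lit 1) (.read 3 [23]))
          (.realLe (.read 16 [23]) (.read 16 [25]))))).Holds s' ↔
        σ j ≠ none ∧ ¬ (σ v ≠ none ∧ wt v ≤ wt j) := by
      simp only [Test.Holds, NatExpr.eval, RealExpr.eval, Store.addr, List.map_cons, List.map_nil,
        h25, hv, hwt', one_le_output hout]
    rw [run]
    simp only [hT]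
    split_ifs with hc
    · refine ⟨j, by simp [run, NatExpr.eval, Store.addr, h25], fun d hd hσd => ?_⟩
      rcases Finset.mem_insert.1 hd with rfl | hd
      · exact ⟨hc.1, le_rfl⟩
      · obtain ⟨h1, h2⟩ := hmin d hd hσd
        exact ⟨hc.1, (not_le.1 fun h => hc.2 ⟨h1, h⟩).le.trans h2⟩
    · refine ⟨v, hv, fun d hd hσd => ?_⟩
      rcases Finset.mem_insert.1 hd with rfl | hd
      · by_contra hno
        exact hc ⟨hσd, hno⟩
      · exact hmin d hd hσd

/-- Finds the product that makes room for the product in the scalar `20`. -/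
def findVictim : Cmd :=
  seq (setNat 23 [] (.read 20 []))
    (ite (.natLe (.lit 1) (.read 3 [20])) skip
      (seq count (ite (.natLe (.read 2 []) (.read 24 [])) findLightest skip)))

theorem run_findVictim {I : PricingInstance n r} {s : Store} {σ : PricedAssortment n r}
    {wt : Fin n → ℝ} {A U : Finset (Fin n × Fin r)} (hs : Represents I s σ wt A U)
    {i : Fin n} (h20 : s.nat 20 [] = (i : ℕ)) :
    ∃ v : Fin n, (findVictim.run s).nat 23 [] = (v : ℕ) ∧ I.IsVictim σ wt i v := by
  rw [findVictim, run]
  have hs1 : Represents I ((setNat 23 [] (.read 20 [])).run s) σ wt A U :=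
    (agree_run _ _).represents hs (by decide) (by decide)
  have h23 : ((setNat 23 [] (.read 20 [])).run s).nat 23 [] = (i : ℕ) := by
    simp [run, NatExpr.eval, Store.addr, h20]
  have h20' : ((setNat 23 [] (.read 20 [])).run s).nat 20 [] = (i : ℕ) := by
    simp [run, NatExpr.eval, Store.addr, h20]
  set s1 := (setNat 23 [] (.read 20 [])).run s
  have hT : (Test.natLe (.lit 1) (.read 3 [20])).Holds s1 ↔ σ i ≠ none := by
    rw [← one_le_output hs1.outputs]
    simp [Test.Holds, NatExpr.eval, Store.addr, h20']
  rw [run]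
  simp only [hT]
  split_ifs with hσ
  · exact ⟨i, h23, Or.inl ⟨rfl, Or.inl hσ⟩⟩
  · rw [not_not] at hσ
    rw [run, run]
    have hs2 : Represents I (count.run s1) σ wt A U :=
      (agree_run _ _).represents hs1 (by decide) (by decide)
    have h24 := run_count hs1.products hs1.outputs
    have h23' : (count.run s1).nat 23 [] = (i : ℕ) := by
      rw [(count.agree_run s1).1 23 (by decide), h23]
    set s2 := count.run s1
    have hT2 : (Test.natLe (.read 2 []) (.read 24 [])).Holds s2 ↔ I.k ≤ (support σ).card := by
      simp [Test.Holds, NatExpr.eval, Store.addr, h24, hs2.limit]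
    simp only [hT2]
    split_ifs with hk
    · obtain ⟨v, hv, hmin⟩ :=
        run_findLightest hs2.products hs2.outputs hs2.weight h23'
      -- For `k = 0` the full assortment is empty and has no lightest product; `IsVictim` then asks
      -- for none.
      exact ⟨v, hv, Or.inr ⟨hσ, hk, fun h1 => hmin (Finset.card_pos.1 (h1.trans hk))⟩⟩
    · exact ⟨i, h23', Or.inl ⟨rfl, Or.inr (not_le.1 hk)⟩⟩

/-- Replaces the product in the scalar `23` by the pair in the scalars `20, 21`. -/
def replace : Cmd :=
  seq (setNat 3 [23] (.lit 0)) (seq (setReal 16 [23] (.lit 0))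
    (seq (setNat 3 [20] (.add (.read 21 []) (.lit 1))) (setReal 16 [20] (.read 17 []))))

/-- Erasing precedes writing, as in `exchange`, so the case `v = e.1` of a mere price change comes
out right. -/
theorem run_replace {I : PricingInstance n r} {s : Store} {σ : PricedAssortment n r}
    {wt : Fin n → ℝ} {A U : Finset (Fin n × Fin r)} (hs : Represents I s σ wt A U)
    {e : Fin n × Fin r} {v : Fin n} {w : ℝ} (h20 : s.nat 20 [] = (e.1 : ℕ))
    (h21 : s.nat 21 [] = (e.2 : ℕ)) (h23 : s.nat 23 [] = (v : ℕ)) (h17 : s.real 17 [] = w) :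
    Represents I (replace.run s) (exchange σ v e)
      (Function.update (Function.update wt v 0) e.1 w) A U where
  products := by simp [replace, run, hs.products]
  ladder := by simp [replace, run, hs.ladder]
  limit := by simp [replace, run, hs.limit]
  outputs i := by
    have := hs.outputs i
    by_cases hie : i = e.1
    · simp [replace, run, NatExpr.eval, Store.addr, h20, h21, exchange, hie]
    · have hie' : ¬ (i : ℕ) = e.1 := fun h => hie (Fin.ext h)
      by_cases hiv : i = v
      · subst hiv
        simp [replace, run, NatExpr.eval, Store.addr, h20, h23, exchange, hie, hie']
      · have hiv' : ¬ (i : ℕ) = v := fun h => hiv (Fin.ext h)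
        simp [replace, run, Store.addr, h20, h23, exchange, hie, hie', hiv, hiv', this]
  accepted d := by simp [replace, run, hs.accepted]
  examined d := by simp [replace, run, hs.examined]
  price := by rw [(agree_run _ _).2 0 (by decide), hs.price]
  init := by rw [(agree_run _ _).2 1 (by decide), hs.init]
  trans := by rw [(agree_run _ _).2 2 (by decide), hs.trans]
  weight i := by
    have := hs.weight i
    by_cases hie : i = e.1
    · simp [replace, run, RealExpr.eval, Store.addr, h20, h17, hie]
    · have hie' : ¬ (i : ℕ) = e.1 := fun h => hie (Fin.ext h)
      by_cases hiv : i = v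
      · subst hiv
        simp [replace, run, RealExpr.eval, Store.addr, h20, h23, hie, hie']
      · have hiv' : ¬ (i : ℕ) = v := fun h => hiv (Fin.ext h)
        simp [replace, run, Store.addr, h20, h23, hie, hie', hiv, hiv', this]

/-- Computes the marginal revenue of the selected pair. -/
def weigh : Cmd :=
  seq (setNat 5 [20, 21] (.lit 1)) (seq (setNat 4 [20, 21] (.lit 1))
    (seq evaluate (setReal 17 [] (.mul (.read 11 [20, 21]) (.read 14 [])))))

/-- The pair is accepted tentatively, since its choice probability refers to `insert e A`, while its
adjusted price, computed for `A`, is kept in a scalar that `evaluate` does not touch. -/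
theorem run_weigh {I : PricingInstance n r} {s : Store} {σ : PricedAssortment n r}
    {wt : Fin n → ℝ} {A U : Finset (Fin n × Fin r)} (hs : Represents I s σ wt A U)
    {e : Fin n × Fin r} (h20 : s.nat 20 [] = (e.1 : ℕ)) (h21 : s.nat 21 [] = (e.2 : ℕ))
    (h14 : s.real 14 [] = I.adjustedPrice A e) :
    Represents I (weigh.run s) σ wt (insert e A) (U.erase e) ∧
      (weigh.run s).real 17 [] = I.marginal A e := by
  set s1 := (setNat 4 [20, 21] (.lit 1)).run ((setNat 5 [20, 21] (.lit 1)).run s) with hs1def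
  have hs1 : Represents I s1 σ wt (insert e A) (U.erase e) := by
    have hpair : ∀ d : Fin n × Fin r, ((d.1 : ℕ) = e.1 ∧ (d.2 : ℕ) = e.2) ↔ d = e :=
      fun d => ⟨fun h => pair_ext h.1 h.2, fun h => by simp [h]⟩
    refine ⟨?_, ?_, ?_, ?_, fun d => ?_, fun d => ?_, hs.price, hs.init, hs.trans, hs.weight⟩
    · simp [hs1def, run, hs.products]
    · simp [hs1def, run, hs.ladder]
    · simp [hs1def, run, hs.limit]
    · intro i
      simp [hs1def, run, hs.outputs i]
    · by_cases hde : d = e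
      · simp [hs1def, run, NatExpr.eval, Store.addr, h20, h21, hde]
      · simp [hs1def, run, Store.addr, h20, h21, hpair, hde, hs.accepted d]
    · by_cases hde : d = e
      · simp [hs1def, run, NatExpr.eval, Store.addr, h20, h21, hde]
      · simp [hs1def, run, Store.addr, h20, h21, hpair, hde, hs.examined d]
  have hs2 : Represents I (evaluate.run s1) σ wt (insert e A) (U.erase e) :=
    (agree_run _ _).represents hs1 (by decide) (by decide)
  refine ⟨(agree_run (setReal 17 [] _) _).represents hs2 (by simp [natWrites])
    (by simp [realWrites]), ?_⟩
  have hev := (run_evaluate hs1.products hs1.ladder hs1.init hs1.trans hs1.accepted).1 e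
    (Finset.mem_insert_self _ _)
  have ha := evaluate.agree_run s1
  have h20' : (evaluate.run s1).nat 20 [] = (e.1 : ℕ) := by
    rw [ha.1 20 (by decide)]
    simp [hs1def, run, h20]
  have h21' : (evaluate.run s1).nat 21 [] = (e.2 : ℕ) := by
    rw [ha.1 21 (by decide)]
    simp [hs1def, run, h21]
  have h14' : (evaluate.run s1).real 14 [] = I.adjustedPrice A e := by
    rw [ha.2 14 (by decide)]
    exact h14
  change ((setReal 17 [] (.mul (.read 11 [20, 21]) (.read 14 []))).run
    (evaluate.run s1)).real 17 [] = _
  simp only [run, RealExpr.eval, Store.addr, List.map_cons, List.map_nil, h20', h21', h14',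
    Store.setReal_real, if_true]
  rw [vec] at hev
  rw [hev, marginal]

/-- One step of the local search. -/
def step : Cmd :=
  seq evaluate (seq select (ite (.natLe (.lit 1) (.read 22 []))
    (seq weigh (seq findVictim
      (ite (.and (.natLe (.lit 1) (.read 2 []))
          (.not (.realLe (.read 17 []) (.mul (.lit 2) (.read 16 [23])))))
        replace (setNat 4 [20, 21] (.lit 0)))))
    skip))

theorem run_step {I : PricingInstance n r} {s : Store} {σ : PricedAssortment n r}
    {wt : Fin n → ℝ} {A U : Finset (Fin n × Fin r)} (hs : Represents I s σ wt A U)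
    (hI : I.Invariant σ wt A U) :
    ∃ σ' wt' A' U', Represents I (step.run s) σ' wt' A' U' ∧ I.Invariant σ' wt' A' U' ∧
      U'.card ≤ U.card - 1 := by
  rw [step, run, run]
  have hs1 : Represents I (evaluate.run s) σ wt A U :=
    (agree_run _ _).represents hs (by decide) (by decide)
  have hmat := (run_evaluate hs.products hs.ladder hs.init hs.trans hs.accepted).2
  set s1 := evaluate.run s
  have hs2 : Represents I (select.run s1) σ wt A U :=
    (agree_run _ _).represents hs1 (by decide) (by decide)
  have hsel := run_select hs1 hI.disjoint hmat
  set s2 := select.run s1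
  have hT : (Test.natLe (.lit 1) (.read 22 [])).Holds s2 ↔ 1 ≤ s2.nat 22 [] := by
    simp [Test.Holds, NatExpr.eval, Store.addr]
  rw [run]
  simp only [hT]
  rcases hsel with ⟨h22, hU⟩ | ⟨h22, e, heU, h20, h21, h14, hmax⟩
  · rw [if_neg (by omega), run]
    exact ⟨σ, wt, A, U, hs2, hI, by simp [hU]⟩
  · rw [if_pos (by omega), run, run]
    have heA : e ∉ A := Finset.disjoint_right.1 hI.disjoint heU
    obtain ⟨hs3, h17⟩ := run_weigh hs2 h20 h21 h14
    have ha3 := weigh.agree_run s2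
    have h20' : (weigh.run s2).nat 20 [] = (e.1 : ℕ) := by rw [ha3.1 20 (by decide), h20]
    have h21' : (weigh.run s2).nat 21 [] = (e.2 : ℕ) := by rw [ha3.1 21 (by decide), h21]
    set s3 := weigh.run s2
    obtain ⟨v, h23, hv⟩ := run_findVictim hs3 h20'
    have hs4 : Represents I (findVictim.run s3) σ wt (insert e A) (U.erase e) :=
      (agree_run _ _).represents hs3 (by decide) (by decide)
    have ha4 := findVictim.agree_run s3
    rw [← ha4.2 17 (by decide)] at h17
    rw [← ha4.1 20 (by decide)] at h20'
    rw [← ha4.1 21 (by decide)] at h21'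
    set s4 := findVictim.run s3
    have hT2 : (Test.and (.natLe (.lit 1) (.read 2 []))
        (.not (.realLe (.read 17 []) (.mul (.lit 2) (.read 16 [23]))))).Holds s4 ↔
        1 ≤ I.k ∧ ¬ I.marginal A e ≤ 2 * wt v := by
      simp [Test.Holds, NatExpr.eval, RealExpr.eval, Store.addr, hs4.limit, h17, h23, hs4.weight]
    rw [run]
    simp only [hT2]
    have hcard : (U.erase e).card ≤ U.card - 1 := (Finset.card_erase_of_mem heU).le
    split_ifs with hacc
    · exact ⟨_, _, _, _, run_replace hs4 h20' h21' h23 h17,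
        hI.accept heU hmax hv hacc.1 (not_le.1 hacc.2), hcard⟩
    -- Rejection takes back the tentative acceptance in array `4`; the mark in array `5` stays.
    · refine ⟨σ, wt, A, U.erase e, ?_, hI.reject heU hv fun hk => ?_, hcard⟩
      · refine ⟨?_, ?_, ?_, ?_, fun d => ?_, fun d => ?_,
          hs4.price, hs4.init, hs4.trans, hs4.weight⟩
        · simp [run, hs4.products]
        · simp [run, hs4.ladder]
        · simp [run, hs4.limit]
        · intro i
          simp [run, hs4.outputs i]
        · by_cases hde : d = e
          · simp [run, NatExpr.eval, Store.addr, h20', h21', hde, heA]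
          · have hne : ¬ ((d.1 : ℕ) = e.1 ∧ (d.2 : ℕ) = e.2) := fun h => hde (pair_ext h.1 h.2)
            simp [run, Store.addr, h20', h21', hne, hde, hs4.accepted d]
        · simp [run, hs4.examined d]
      · by_contra hno
        exact hacc ⟨hk, hno⟩

/-- The local search. -/
def localSearch : Cmd := loopPair 10 11 step

/-- Unused cells are `0`, which encodes "not offered", "not accepted", "not yet examined" and weight
zero, so no initialization is needed. -/
theorem represents_input (I : PricingInstance n r) :
    Represents I I.input (fun _ => none) (fun _ => 0) ∅ Finset.univ where
  products := rfl
  ladder := rfl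
  limit := rfl
  outputs _ := rfl
  accepted e := by simp [input, inputNat]
  examined e := by simp [input, inputNat]
  price := rfl
  init := rfl
  trans := rfl
  weight _ := rfl

theorem run_localSearch (I : PricingInstance n r) :
    ∃ σ wt A, Represents I (localSearch.run I.input) σ wt A ∅ ∧ I.Invariant σ wt A ∅ := by
  have h := run_loopPair (n := n) (r := r) (s := I.input) (c := step) (v := 10) (w := 11) rfl rfl rfl
    (fun (D : Finset (Fin n × Fin r)) s => ∃ σ wt A U, Represents I s σ wt A U ∧
      I.Invariant σ wt A U ∧ U.card + D.card ≤ Fintype.card (Fin n × Fin r))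
    ?_ ?_ ⟨_, _, _, _, represents_input I, I.invariant_initial, by simp⟩ ?_
  · obtain ⟨σ, wt, A, U, hs, hI, hcard⟩ := h
    have hU : U = ∅ := by
      rw [Finset.card_univ] at hcard
      exact Finset.card_eq_zero.1 (by omega)
    exact ⟨σ, wt, A, hU ▸ hs, hU ▸ hI⟩
  · rintro D s x ⟨σ, wt, A, U, hs, h⟩
    exact ⟨σ, wt, A, U, hs.congr (fun a ha => Store.setNat_nat_of_ne _ _ _ (by omega))
      rfl rfl rfl rfl, h⟩
  · rintro D s x ⟨σ, wt, A, U, hs, h⟩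
    exact ⟨σ, wt, A, U, hs.congr (fun a ha => Store.setNat_nat_of_ne _ _ _ (by omega))
      rfl rfl rfl rfl, h⟩
  · rintro D e s he - - - ⟨σ, wt, A, U, hs, hI, hcard⟩
    obtain ⟨σ', wt', A', U', hs', hI', hcard'⟩ := run_step hs hI
    refine ⟨σ', wt', A', U', hs', hI', ?_⟩
    -- Needed if `U` is already empty: the truncated subtraction then gives no decrease, but the
    -- number of rounds alone is within the bound.
    have h1 := Finset.card_le_univ (insert e D)
    rw [Finset.card_insert_of_notMem he] at h1 ⊢
    omega

end Cmd

end RealRAM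

theorem corollary10 :
    ∃ (P : RealRAM.Prog) (q : Polynomial ℕ),
      ∀ (n r : ℕ) (I : PricingInstance n r),
        ∃ (t : ℕ) (s : RealRAM.Store) (σ : PricedAssortment n r),
          RealRAM.Exec P I.input t s ∧ t ≤ q.eval (n + r) ∧ s.Outputs σ ∧
            I.Feasible σ ∧
            ∀ τ : PricedAssortment n r, I.Feasible τ →
              (1 / 4 : ℝ) * I.revenue τ ≤ I.revenue σ := by
  refine ⟨RealRAM.Cmd.localSearch.toProg, RealRAM.Cmd.localSearch.time, fun n r I => ?_⟩
  obtain ⟨t, ht, hexec⟩ := RealRAM.Cmd.exec_run (c := RealRAM.Cmd.localSearch) rfl I.input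
    (n + r) rfl
  obtain ⟨σ, wt, A, hs, hI⟩ := RealRAM.Cmd.run_localSearch I
  exact ⟨t, _, σ, hexec, ht, hs.outputs, hI.feasible, hI.quarter_le⟩
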